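/- **Setting.** Let $G$ be a simply connected Lie group with Lie algebra $\mathfrak g$ and $K\subset G$ a compact connected Lie subgroup with Lie algebra $\mathfrak k$, such that $G/K$ is almost effective, i.e. $\{a\in K: a \text{ acts trivially on } G/K\}$ is discrete. Let $\mathfrak g=\mathfrak k\oplus\mathfrak p$ be a reductive decomposition ($\mathrm{Ad}(K)\mathfrak p\subset\mathfrak p$), so that $T_o(G/K)\equiv\mathfrak p$ and $G$-invariant tensor fields on $G/K$ are identified with $\mathrm{Ad}(K)$-invariant tensors on $\mathfrak p$. Let $h\cdot\gamma$ and $\theta(A)\gamma$ denote the usual left action of $h\in\mathrm{GL}(\mathfrak p)$ and the corresponding representation of $A\in\mathfrak{gl}(\mathfrak p)$ on finite tuples of tensors of a fixed type $(r,s)$ on $\mathfrak p$, and set $\mathfrak{gl}(\mathfrak p)_\gamma=\{A:\theta(A)\gamma=0\}$. Let $\mathcal O$ be a single $\mathrm{GL}(\mathfrak p)$-orbit of such tuples (the non-degenerate ones). For every $\gamma\in\mathcal O$ let a complement $\mathfrak q_\gamma$, $\mathfrak{gl}(\mathfrak p)=\mathfrak{gl}(\mathfrak p)_\gamma\oplus\mathfrak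 q_\gamma$, and an inner product $g_\gamma$ on $\mathfrak p$ be given such that $I\in\mathfrak q_\gamma$, $\mathfrak q_{h\cdot\gamma}=h\,\mathfrak q_\gamma h^{-1}$ and $g_{h\cdot\gamma}=g_\gamma(h^{-1}\cdot,h^{-1}\cdot)$ for all $h\in\mathrm{GL}(\mathfrak p)$. Let $\Gamma\subset\mathcal O$ be a space of $\mathrm{Ad}(K)$-invariant structures, and let $\gamma\mapsto q(\gamma)\in T_\gamma\Gamma$ be a locally Lipschitz map on $\Gamma$ (the preferred direction), with the following two properties. * For some $\alpha<1$: $c\gamma\in\Gamma$ and $q(c\gamma)=c^\alpha q(\gamma)$ for all $c>0$, $\gamma\in\Gamma$. * $\Gamma$ is invariant under, and $q$ is equivariant for, $\mathrm{Aut}(G/K)\cong\{\varphi\in\mathrm{Aut}(\mathfrak g):\varphi(\mathfrak k)=\mathfrak k\}$, where $\varphi=\begin{bmatrix}*&*\\0&h\end{bmatrix}$ acts by $\gamma\mapsto h\cdot\gamma$. Write $\mathrm{Der}(\mathfrak g/\mathfrak k)=\{D\in\mathrm{Der}(\mathfrak g):D\mathfrak k\subset\mathfrak k\}$, let $D_{\mathfrak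 p}\in\mathfrak{gl}(\mathfrak p)$ be the map induced by $D$ on $\mathfrak p\equiv\mathfrak g/\mathfrak k$, and let $Q_\gamma\in\mathfrak q_\gamma$ be the unique operator with $q(\gamma)=\theta(Q_\gamma)\gamma$. **Definitions.** Let $\gamma\in\Gamma$. * $(G/K,\gamma)$ is a *semi-algebraic soliton* if $q(\gamma)=c\gamma+\theta(D_{\mathfrak p})\gamma$ for some $c\in\mathbb R$ and $D\in\mathrm{Der}(\mathfrak g/\mathfrak k)$. * It is an *algebraic soliton* if this holds for some $c\in\mathbb R$ and some $D\in\mathrm{Der}(\mathfrak g/\mathfrak k)$ with $D_{\mathfrak p}\in\mathfrak q_\gamma$. * It is *flow diagonal* if there is a $g_\gamma$-orthonormal basis $\beta$ of $\mathfrak p$ such that the matrix $[Q_{\gamma(t)}]_\beta$ is diagonal for all $t$ in the interval of existence of the invariant solution $\gamma(t)\in\Gamma$ of $\frac{d}{dt}\gamma(t)=q(\gamma(t))$, $\gamma(0)=\gamma$. **Theorem.** Let $(G/K,\gamma)$, $\gamma\in\Gamma$, be a semi-algebraic soliton (with $K$ compact, as above) such that $Q_\gamma$ is symmetric with respect to $g_\gamma$.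 Then $(G/K,\gamma)$ is flow diagonal if and only if it is an algebraic soliton. -/

import Mathlib

open scoped Manifold ContDiff TensorProduct Topology

noncomputable section

namespace HomSoliton

/-! ## Tensors on a finite-dimensional real vector space -/

section Tensors

/-- Tensors of type `(r, s)`: multilinear maps `P × ⋯ × P → P ⊗ ⋯ ⊗ P`. -/
abbrev Tensor (P : Type*) [AddCommGroup P] [Module ℝ P] (r s : ℕ) : Type _ :=
  MultilinearMap ℝ (fun _ : Fin r => P) (⨂[ℝ] _ : Fin s, P)

/-- Tuples, indexed by `ι`, of tensors of type `(r, s)`. -/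
abbrev Tuple (ι : Type*) (P : Type*) [AddCommGroup P] [Module ℝ P] (r s : ℕ) : Type _ :=
  ι → Tensor P r s

variable {ι P : Type*} [AddCommGroup P] [Module ℝ P] {r s : ℕ}

/-- The left action `h · γ = h ·ₛ γ(h⁻¹ ·, …, h⁻¹ ·)` of `GL(P)`. -/
def act (h : P ≃ₗ[ℝ] P) (γ : Tuple ι P r s) : Tuple ι P r s := fun i =>
  (PiTensorProduct.map fun _ : Fin s => (h : P →ₗ[ℝ] P)).compMultilinearMap
    ((γ i).compLinearMap fun _ => (h.symm : P →ₗ[ℝ] P))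

/-- The representation of `gl(P)` on `P ⊗ ⋯ ⊗ P`: the endomorphism `A` acts as a derivation. -/
def thetaTensorPower (s : ℕ) (A : Module.End ℝ P) : Module.End ℝ (⨂[ℝ] _ : Fin s, P) :=
  ∑ j : Fin s, PiTensorProduct.map (Function.update (fun _ => (LinearMap.id : P →ₗ[ℝ] P)) j A)

/-- The representation of `gl(P)` on tensors,
`θ(A)γ = θₛ(A)γ - γ(A ·, …, ·) - ⋯ - γ(·, …, A ·)`. -/
def theta (A : Module.End ℝ P) (γ : Tuple ι P r s) : Tuple ι P r s := fun i =>
  (thetaTensorPower s A).compMultilinearMap (γ i) -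
    ∑ j : Fin r, (γ i).compLinearMap (Function.update (fun _ => (LinearMap.id : P →ₗ[ℝ] P)) j A)

theorem theta_add (A B : Module.End ℝ P) (γ : Tuple ι P r s) :
    theta (A + B) γ = theta A γ + theta B γ := by
  have h1 : thetaTensorPower s (A + B) = thetaTensorPower s A + thetaTensorPower s B := by
    simp only [thetaTensorPower, PiTensorProduct.map_update_add, Finset.sum_add_distrib]
  have h2 : ∀ i, ∀ j : Fin r, (γ i).compLinearMap
      (Function.update (fun _ => (LinearMap.id : P →ₗ[ℝ] P)) j (A + B)) =
      (γ i).compLinearMap (Function.update (fun _ => (LinearMap.id : P →ₗ[ℝ] P)) j A) +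
      (γ i).compLinearMap (Function.update (fun _ => (LinearMap.id : P →ₗ[ℝ] P)) j B) := fun i j =>
    (MultilinearMap.compLinearMapMultilinear (R := ℝ) (ι := Fin r) (M₁ := fun _ => P)
      (M₁' := fun _ => P) (M₂ := ⨂[ℝ] _ : Fin s, P)).map_update_add
        (fun _ => LinearMap.id) j A B |> fun h => congrArg (fun f => f (γ i)) h
  funext i
  ext v
  simp only [theta, h1, h2, Finset.sum_add_distrib, Pi.add_apply, add_apply,
    sub_apply, LinearMap.compMultilinearMap_apply, LinearMap.add_apply]
  abel

theorem theta_smul (c : ℝ) (A : Module.End ℝ P) (γ : Tuple ι P r s) :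
    theta (c • A) γ = c • theta A γ := by
  have h1 : thetaTensorPower s (c • A) = c • thetaTensorPower s A := by
    simp only [thetaTensorPower, PiTensorProduct.map_update_smul, Finset.smul_sum]
  have h2 : ∀ i, ∀ j : Fin r, (γ i).compLinearMap
      (Function.update (fun _ => (LinearMap.id : P →ₗ[ℝ] P)) j (c • A)) =
      c • (γ i).compLinearMap (Function.update (fun _ => (LinearMap.id : P →ₗ[ℝ] P)) j A) :=
    fun i j =>
    (MultilinearMap.compLinearMapMultilinear (R := ℝ) (ι := Fin r) (M₁ := fun _ => P)
      (M₁' := fun _ => P) (M₂ := ⨂[ℝ] _ : Fin s, P)).map_update_smul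
        (fun _ => LinearMap.id) j c A |> fun h => congrArg (fun f => f (γ i)) h
  funext i
  ext v
  simp only [theta, h1, h2, ← Finset.smul_sum, Pi.smul_apply, smul_apply,
    sub_apply, LinearMap.compMultilinearMap_apply, LinearMap.smul_apply, smul_sub]

/-- The Lie algebra `gl(P)_γ = {A | θ(A)γ = 0}` of the stabilizer of `γ` in `GL(P)`. -/
def stab (γ : Tuple ι P r s) : Submodule ℝ (Module.End ℝ P) where
  carrier := {A | theta A γ = 0}
  add_mem' {A B} hA hB := by
    have hA' : theta A γ = 0 := hA
    have hB' : theta B γ = 0 := hB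
    simp [theta_add, hA', hB']
  zero_mem' := by
    have h := theta_smul (0 : ℝ) (0 : Module.End ℝ P) γ
    simpa using h
  smul_mem' c A hA := by
    have hA' : theta A γ = 0 := hA
    simp [theta_smul, hA']

end Tensors

/-! ## Elementary calculus in a finite-dimensional real vector space, through linear coordinates -/

section Coordinates

variable (V : Type*) [AddCommGroup V] [Module ℝ V] [Module.Finite ℝ V]

/-- Linear coordinates; the notions defined through them do not depend on the basis. -/
def coords : V ≃ₗ[ℝ] (Fin (Module.finrank ℝ V) → ℝ) := (Module.finBasis ℝ V).equivFun

variable {V}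

/-- The curve `σ` has velocity `v` at time `t`. -/
def HasVelocity (σ : ℝ → V) (v : V) (t : ℝ) : Prop :=
  HasDerivAt (fun u => coords V (σ u)) (coords V v) t

/-- `v` is tangent to the set `Γ` at `γ`: it is the velocity of a curve in `Γ` through `γ`. -/
def IsTangent (Γ : Set V) (γ v : V) : Prop :=
  ∃ σ : ℝ → V, σ 0 = γ ∧ (∀ᶠ t in 𝓝 (0 : ℝ), σ t ∈ Γ) ∧ HasVelocity σ v 0

/-- The map `q` is locally Lipschitz on `Γ`. -/
def IsLocallyLipschitzOn (q : V → V) (Γ : Set V) : Prop :=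
  LocallyLipschitzOn (coords V '' Γ) (fun x => coords V (q ((coords V).symm x)))

end Coordinates

/-! ## Types of geometric structures, from the point of view of operators -/

/-- A type of geometric structures on the vector space `P` that are given by tensors (or tuples of
tensors) of type `(r, s)` and come with a Riemannian metric: a class of non-degenerate tensors which
is a single `GL(P)`-orbit, together with, for `γ` in it,

* the complement `q_γ` in the decomposition `gl(P) = gl(P)_γ ⊕ q_γ`, which is natural in `γ`
  (in particular it is invariant under the stabilizer of `γ`), and contains the identity (for
  example, the complement of `gl(P)_γ` that is orthogonal for the inner product of `gl(P)` which
  `g_γ` determines);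
* the inner product `g_γ` determined by `γ`, which is also natural in `γ`. -/
structure GeometryType (ι : Type*) [Finite ι] (P : Type*) [AddCommGroup P] [Module ℝ P]
    [Module.Finite ℝ P] (r s : ℕ) where
  /-- the class of non-degenerate tensors -/
  nondeg : Set (Tuple ι P r s)
  nondeg_eq_orbit : ∀ γ ∈ nondeg, nondeg = Set.range fun h : P ≃ₗ[ℝ] P => act h γ
  /-- the complement `q_γ` of `gl(P)_γ` -/
  compl : Tuple ι P r s → Submodule ℝ (Module.End ℝ P)
  isCompl : ∀ γ ∈ nondeg, IsCompl (stab γ) (compl γ)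
  compl_act : ∀ γ ∈ nondeg, ∀ h : P ≃ₗ[ℝ] P,
    compl (act h γ) = (compl γ).map (h.conj : Module.End ℝ P →ₗ[ℝ] Module.End ℝ P)
  id_mem_compl : ∀ γ ∈ nondeg, LinearMap.id ∈ compl γ
  /-- the inner product `g_γ` -/
  metric : Tuple ι P r s → LinearMap.BilinForm ℝ P
  metric_symm : ∀ γ ∈ nondeg, ∀ x y, metric γ x y = metric γ y x
  metric_pos : ∀ γ ∈ nondeg, ∀ x, x ≠ 0 → 0 < metric γ x x
  metric_act : ∀ γ ∈ nondeg, ∀ (h : P ≃ₗ[ℝ] P) (x y : P),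
    metric (act h γ) x y = metric γ (h.symm x) (h.symm y)

/-! ## Homogeneous spaces `G/K` -/

section Homogeneous

variable {E : Type*} [NormedAddCommGroup E] [NormedSpace ℝ E]
  {G : Type*} [TopologicalSpace G] [ChartedSpace E G] [Group G]

instance lieGroup_minSmoothness [LieGroup 𝓘(ℝ, E) ∞ G] :
    LieGroup 𝓘(ℝ, E) (minSmoothness ℝ 3) G := by
  rw [minSmoothness_of_isRCLikeNormedField]
  infer_instance

instance finiteDimensional_lieAlgebra [FiniteDimensional ℝ E] :
    FiniteDimensional ℝ (GroupLieAlgebra 𝓘(ℝ, E) G) :=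
  inferInstanceAs (FiniteDimensional ℝ E)

/-- The adjoint representation: `Ad z` is the derivative at the identity of `a ↦ z a z⁻¹`. -/
def Ad (E : Type*) [NormedAddCommGroup E] [NormedSpace ℝ E] {G : Type*} [TopologicalSpace G]
    [ChartedSpace E G] [Group G] (z : G) :
    GroupLieAlgebra 𝓘(ℝ, E) G →ₗ[ℝ] GroupLieAlgebra 𝓘(ℝ, E) G :=
  (mfderiv 𝓘(ℝ, E) 𝓘(ℝ, E) (fun a : G => z * a * z⁻¹) 1).toLinearMap

variable {F : Type*} [NormedAddCommGroup F] [NormedSpace ℝ F]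

/-- The Lie group structure that `K` carries makes it a Lie subgroup of `G`: the inclusion is a
smooth immersion. (It is a topological embedding since `K` carries the subspace topology.) By
Cartan's theorem every closed subgroup has exactly one such structure. -/
def IsLieSubgroup (E F : Type*) [NormedAddCommGroup E] [NormedSpace ℝ E]
    [NormedAddCommGroup F] [NormedSpace ℝ F] {G : Type*} [TopologicalSpace G] [ChartedSpace E G]
    [Group G] (K : Subgroup G) [ChartedSpace F K] : Prop :=
  ContMDiff 𝓘(ℝ, F) 𝓘(ℝ, E) ∞ (fun z : K => (z : G)) ∧
    ∀ z : K, Function.Injective (mfderiv 𝓘(ℝ, F) 𝓘(ℝ, E) (fun z : K => (z : G)) z)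

/-- The Lie algebra `𝔨 ⊆ 𝔤` of `K`: the tangent space of `K` at the identity. -/
def isotropyAlgebra (E F : Type*) [NormedAddCommGroup E] [NormedSpace ℝ E]
    [NormedAddCommGroup F] [NormedSpace ℝ F] {G : Type*} [TopologicalSpace G] [ChartedSpace E G]
    [Group G] (K : Subgroup G) [ChartedSpace F K] : Submodule ℝ (GroupLieAlgebra 𝓘(ℝ, E) G) :=
  LinearMap.range (mfderiv 𝓘(ℝ, F) 𝓘(ℝ, E) (fun z : K => (z : G)) 1).toLinearMap

/-- `𝔤 = 𝔨 ⊕ 𝔭` is a reductive decomposition: `Ad(K)𝔭 ⊆ 𝔭`. -/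
def IsReductive (F : Type*) [NormedAddCommGroup F] [NormedSpace ℝ F] (K : Subgroup G)
    [ChartedSpace F K] (𝔭 : Submodule ℝ (GroupLieAlgebra 𝓘(ℝ, E) G)) : Prop :=
  IsCompl (isotropyAlgebra E F K) 𝔭 ∧ ∀ z ∈ K, ∀ x ∈ 𝔭, Ad E z x ∈ 𝔭

/-- The endomorphism `φ` of `𝔤 = 𝔨 ⊕ 𝔭` has the block form `[* *; 0 h]`: it preserves `𝔨` and
induces `h` on `𝔭 ≅ 𝔤/𝔨`. -/
def IsBlock {L : Type*} [AddCommGroup L] [Module ℝ L] (𝔨 𝔭 : Submodule ℝ L)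
    (φ : L →ₗ[ℝ] L) (h : 𝔭 →ₗ[ℝ] 𝔭) : Prop :=
  (∀ x ∈ 𝔨, φ x ∈ 𝔨) ∧ ∀ x : 𝔭, φ x - h x ∈ 𝔨

/-- A space `Γ` of `G`-invariant geometric structures on `G/K` of the type `𝒢` together with a
preferred direction `q`, everything being read at the origin, where the tangent space is `𝔭`.
The group `Aut(G/K)` of equivariant diffeomorphisms acts through
`Aut(𝔤/𝔨) = {φ ∈ Aut(𝔤) | φ(𝔨) = 𝔨}`, to which it is isomorphic if `G` is simply connected and
`K` is connected. -/
structure PreferredDirection [FiniteDimensional ℝ E] [LieGroup 𝓘(ℝ, E) ∞ G]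
    (F : Type*) [NormedAddCommGroup F] [NormedSpace ℝ F] (K : Subgroup G) [ChartedSpace F K]
    (𝔭 : Submodule ℝ (GroupLieAlgebra 𝓘(ℝ, E) G)) {ι : Type*} [Finite ι] {r s : ℕ}
    (𝒢 : GeometryType ι 𝔭 r s) where
  /-- the space of `G`-invariant structures -/
  Γ : Set (Tuple ι 𝔭 r s)
  nondeg : Γ ⊆ 𝒢.nondeg
  ad_invariant : ∀ γ ∈ Γ, ∀ z ∈ K, ∀ h : 𝔭 ≃ₗ[ℝ] 𝔭,
    (∀ x : 𝔭, ((h x : 𝔭) : GroupLieAlgebra 𝓘(ℝ, E) G) = Ad E z x) → act h γ = γ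
  /-- the preferred direction; only its values on `Γ` matter -/
  q : Tuple ι 𝔭 r s → Tuple ι 𝔭 r s
  q_tangent : ∀ γ ∈ Γ, IsTangent Γ γ (q γ)
  q_lipschitz : IsLocallyLipschitzOn q Γ
  /-- the scaling exponent -/
  α : ℝ
  α_lt_one : α < 1
  smul_mem : ∀ γ ∈ Γ, ∀ c : ℝ, 0 < c → c • γ ∈ Γ
  q_smul : ∀ γ ∈ Γ, ∀ c : ℝ, 0 < c → q (c • γ) = c ^ α • q γ
  aut_mem : ∀ γ ∈ Γ,
    ∀ (φ : GroupLieAlgebra 𝓘(ℝ, E) G ≃ₗ⁅ℝ⁆ GroupLieAlgebra 𝓘(ℝ, E) G) (h : 𝔭 ≃ₗ[ℝ] 𝔭),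
    IsBlock (isotropyAlgebra E F K) 𝔭 (φ : GroupLieAlgebra 𝓘(ℝ, E) G →ₗ[ℝ] _) h → act h γ ∈ Γ
  q_aut : ∀ γ ∈ Γ,
    ∀ (φ : GroupLieAlgebra 𝓘(ℝ, E) G ≃ₗ⁅ℝ⁆ GroupLieAlgebra 𝓘(ℝ, E) G) (h : 𝔭 ≃ₗ[ℝ] 𝔭),
    IsBlock (isotropyAlgebra E F K) 𝔭 (φ : GroupLieAlgebra 𝓘(ℝ, E) G →ₗ[ℝ] _) h →
      q (act h γ) = act h (q γ)

namespace PreferredDirection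

variable [FiniteDimensional ℝ E] [LieGroup 𝓘(ℝ, E) ∞ G]
  {K : Subgroup G} [ChartedSpace F K] {𝔭 : Submodule ℝ (GroupLieAlgebra 𝓘(ℝ, E) G)}
  {ι : Type*} [Finite ι] {r s : ℕ} {𝒢 : GeometryType ι 𝔭 r s}
  (Φ : PreferredDirection F K 𝔭 𝒢)

/-- `Q = Q_γ`, the operator in `q_γ` with `q(γ) = θ(Q)γ`; it is unique as `q_γ` is a complement of
`gl(𝔭)_γ`. -/
def IsOperator (γ : Tuple ι 𝔭 r s) (Q : Module.End ℝ 𝔭) : Prop :=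
  Q ∈ 𝒢.compl γ ∧ Φ.q γ = theta Q γ

/-- `σ` is a `G`-invariant solution of `dγ/dt = q(γ(t))` on the open interval `J` around `0`. -/
def IsSolution (J : Set ℝ) (σ : ℝ → Tuple ι 𝔭 r s) : Prop :=
  IsOpen J ∧ J.OrdConnected ∧ (0 : ℝ) ∈ J ∧
    ∀ t ∈ J, σ t ∈ Φ.Γ ∧ HasVelocity σ (Φ.q (σ t)) t

/-- `q(γ) = cγ + θ(D_𝔭)γ` for some `c ∈ ℝ` and `D = [* *; 0 D_𝔭] ∈ Der(𝔤/𝔨)`. -/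
def IsSemiAlgebraicSoliton (γ : Tuple ι 𝔭 r s) : Prop :=
  ∃ (c : ℝ) (D : LieDerivation ℝ (GroupLieAlgebra 𝓘(ℝ, E) G) (GroupLieAlgebra 𝓘(ℝ, E) G))
    (Dp : Module.End ℝ 𝔭),
    IsBlock (isotropyAlgebra E F K) 𝔭 D.toLinearMap Dp ∧ Φ.q γ = c • γ + theta Dp γ

/-- `q(γ) = cγ + θ(D_𝔭)γ` for some `c ∈ ℝ` and `D = [* *; 0 D_𝔭] ∈ Der(𝔤/𝔨)` such that in addition
`D_𝔭 ∈ q_γ`, i.e. `D_𝔭` equals its projection to `q_γ`. -/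
def IsAlgebraicSoliton (γ : Tuple ι 𝔭 r s) : Prop :=
  ∃ (c : ℝ) (D : LieDerivation ℝ (GroupLieAlgebra 𝓘(ℝ, E) G) (GroupLieAlgebra 𝓘(ℝ, E) G))
    (Dp : Module.End ℝ 𝔭),
    IsBlock (isotropyAlgebra E F K) 𝔭 D.toLinearMap Dp ∧ Φ.q γ = c • γ + theta Dp γ ∧
      Dp ∈ 𝒢.compl γ

/-- There is a `g_γ`-orthonormal basis `β` of `𝔭` such that `[Q_{γ(t)}]_β` is diagonal for all `t`,
where `γ(t)` is the invariant solution starting at `γ`. Since solutions are unique, the maximal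
solution is the union of all solutions, and it is enough to speak about all times of these. -/
def IsFlowDiagonal (γ : Tuple ι 𝔭 r s) : Prop :=
  ∃ β : Module.Basis (Fin (Module.finrank ℝ 𝔭)) ℝ 𝔭,
    (∀ i j, 𝒢.metric γ (β i) (β j) = if i = j then 1 else 0) ∧
    ∀ (J : Set ℝ) (σ : ℝ → Tuple ι 𝔭 r s), Φ.IsSolution J σ → σ 0 = γ →
      ∀ t ∈ J, ∃ Q : Module.End ℝ 𝔭, Φ.IsOperator (σ t) Q ∧ (LinearMap.toMatrix β β Q).IsDiag

end PreferredDirection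

end Homogeneous

end HomSoliton

end

open scoped Manifold ContDiff TensorProduct Topology

noncomputable section

/-! Write `q(γ) = cγ + θ(X)γ` with `X = D_𝔭`, and let `A = (c/(s-r)) I + X`, so that `θ(A)γ = q(γ)`.
Each `e^{uD}` is an automorphism, so `q` is equivariant under `e^{uX}`. Together with homogeneity
this shows that the flow line of `γ` is `e^{s(t)A}·γ` with `s' = e^{-(1-α)cs}`, and that its
operator is `e^{-(1-α)cs} e^{sA} Q e^{-sA}`.

If these operators are diagonal in one basis, differentiating at `s = 0` shows that `[A,Q]` is
diagonal. A commutator with a diagonal matrix has zero diagonal, hence `[A,Q] = 0`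
(`commute_of_isDiag_conj`). The difference `N = A - Q` annihilates `γ`, so it is `g_γ`-skew
(`metric_skew`), and `X = S + N` with `S = Q - (c/(s-r)) I` symmetric and commuting with `N`. Thus
`S` is the real part of the normal operator `X` (`realPart_of_normal`). The real part of a
derivation is a derivation, because brackets add eigenvalues (`exists_derivation_of_retraction`). It
induces `S ∈ q_γ` on `𝔭`, so the soliton is algebraic.

Conversely, if `X ∈ q_γ` then `A ∈ q_γ`, so `A = Q`. Conjugation by `e^{sA}` then fixes `Q`, and an
orthonormal eigenbasis of `Q` diagonalizes all operators on the flow line. No solution outlives the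
explicit one: a limit at a finite end would be fixed by every `e^{uA}`, forcing `A = 0`
(`solution_eq_soliton`). -/

namespace HomSoliton

/-! ### Calculus of velocities in finite-dimensional spaces -/

section Velocity

variable {V W X : Type*} [AddCommGroup V] [Module ℝ V] [Module.Finite ℝ V]
  [AddCommGroup W] [Module ℝ W] [Module.Finite ℝ W]
  [AddCommGroup X] [Module ℝ X] [Module.Finite ℝ X]

/-- Coordinates are a continuous linear isomorphism for any norm. Bare vector spaces below receive
the norm pulled back from coordinates, which makes the usual calculus available. -/
theorem hasVelocity_iff_hasDerivAt {N : Type*} [NormedAddCommGroup N] [NormedSpace ℝ N]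
    [FiniteDimensional ℝ N] {σ : ℝ → N} {v : N} {t : ℝ} :
    HasVelocity σ v t ↔ HasDerivAt σ v t := by
  constructor
  · intro h
    have := (LinearMap.toContinuousLinearMap (coords N).symm.toLinearMap).hasFDerivAt.comp_hasDerivAt
      t h
    simpa [Function.comp_def, HasVelocity] using this
  · intro h
    have := (LinearMap.toContinuousLinearMap (coords N).toLinearMap).hasFDerivAt.comp_hasDerivAt
      t h
    simpa [Function.comp_def, HasVelocity] using this

theorem MultilinearMap.continuous_of_finiteDimensional {κ : Type*} [Fintype κ] {N : κ → Type*}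
    [∀ j, NormedAddCommGroup (N j)] [∀ j, NormedSpace ℝ (N j)] [∀ j, FiniteDimensional ℝ (N j)]
    {M : Type*} [NormedAddCommGroup M] [NormedSpace ℝ M] (f : MultilinearMap ℝ N M) :
    Continuous f := by
  classical
  let b := fun j => Module.finBasis ℝ (N j)
  have h : ∀ x, f x = ∑ k : ∀ j, Fin (Module.finrank ℝ (N j)),
      (∏ j, (b j).repr (x j) (k j)) • f fun j => b j (k j) := by
    intro x
    conv_lhs => rw [show x = fun j => ∑ k, (b j).repr (x j) k • b j k from
      funext fun j => ((b j).sum_repr (x j)).symm]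
    rw [f.map_sum]
    exact Finset.sum_congr rfl fun k _ => f.map_smul_univ _ _
  refine Continuous.congr ?_ fun x => (h x).symm
  refine continuous_finsetSum _ fun k _ => Continuous.smul ?_ continuous_const
  refine continuous_finsetProd _ fun j _ => ?_
  exact ((b j).coord (k j)).continuous_of_finiteDimensional.comp (continuous_apply j)

theorem HasVelocity.multilinear {κ : Type*} [Fintype κ] [DecidableEq κ] {N : κ → Type*}
    [∀ j, AddCommGroup (N j)] [∀ j, Module ℝ (N j)] [∀ j, Module.Finite ℝ (N j)]
    (f : MultilinearMap ℝ N W) {x : ∀ j, ℝ → N j} {v : ∀ j, N j} {t : ℝ}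
    (h : ∀ j, HasVelocity (x j) (v j) t) :
    HasVelocity (fun u => f fun j => x j u)
      (∑ j, f (Function.update (fun i => x i t) j (v j))) t := by
  let _ : ∀ j, NormedAddCommGroup (N j) := fun j => NormedAddCommGroup.induced _ _ (coords (N j))
    (coords (N j)).injective
  let _ : ∀ j, NormedSpace ℝ (N j) := fun j => NormedSpace.induced ℝ _ _ (coords (N j))
  let : NormedAddCommGroup W := NormedAddCommGroup.induced _ _ (coords W) (coords W).injective
  let : NormedSpace ℝ W := NormedSpace.induced ℝ _ _ (coords W)
  rw [hasVelocity_iff_hasDerivAt]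
  let F : ContinuousMultilinearMap ℝ N W := ⟨f, MultilinearMap.continuous_of_finiteDimensional f⟩
  have h' : ∀ j, HasDerivAt (x j) (v j) t := fun j => hasVelocity_iff_hasDerivAt.1 (h j)
  have := (F.hasFDerivAt fun j => x j t).comp_hasDerivAt t (hasDerivAt_pi.2 h')
  rw [ContinuousMultilinearMap.linearDeriv_apply] at this
  exact this

theorem HasVelocity.linear (T : V →ₗ[ℝ] W) {σ : ℝ → V} {v : V} {t : ℝ}
    (h : HasVelocity σ v t) : HasVelocity (fun u => T (σ u)) (T v) t := by
  have := (LinearMap.toContinuousLinearMap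
    ((coords W).toLinearMap ∘ₗ T ∘ₗ (coords V).symm.toLinearMap)).hasFDerivAt.comp_hasDerivAt t h
  simpa [Function.comp_def, HasVelocity] using this

theorem HasVelocity.const (v : V) (t : ℝ) : HasVelocity (fun _ => v) 0 t := by
  unfold HasVelocity
  rw [map_zero]
  exact hasDerivAt_const _ _

theorem HasVelocity.scomp {σ : ℝ → V} {v : V} {s : ℝ → ℝ} {s' t : ℝ}
    (h : HasVelocity σ v (s t)) (hs : HasDerivAt s s' t) :
    HasVelocity (fun u => σ (s u)) (s' • v) t := by
  unfold HasVelocity at *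
  rw [map_smul]
  exact HasDerivAt.scomp t h hs

theorem HasVelocity.congr_of_eventuallyEq {σ τ : ℝ → V} {v : V} {t : ℝ}
    (h : HasVelocity σ v t) (he : ∀ᶠ u in 𝓝 t, τ u = σ u) : HasVelocity τ v t :=
  HasDerivAt.congr_of_eventuallyEq h (he.mono fun _ hu => congrArg _ hu)

theorem HasVelocity.unique {σ : ℝ → V} {v w : V} {t : ℝ}
    (h : HasVelocity σ v t) (k : HasVelocity σ w t) : v = w :=
  (coords V).injective (HasDerivAt.unique h k)

/-- The product rule for a bilinear map. -/
theorem HasVelocity.bilinear (B : V →ₗ[ℝ] W →ₗ[ℝ] X) {σ : ℝ → V} {τ : ℝ → W} {v : V} {w : W}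
    {t : ℝ} (h : HasVelocity σ v t) (k : HasVelocity τ w t) :
    HasVelocity (fun u => B (σ u) (τ u)) (B v (τ t) + B (σ t) w) t := by
  let : NormedAddCommGroup V := NormedAddCommGroup.induced _ _ (coords V) (coords V).injective
  let : NormedSpace ℝ V := NormedSpace.induced ℝ _ _ (coords V)
  let : NormedAddCommGroup W := NormedAddCommGroup.induced _ _ (coords W) (coords W).injective
  let : NormedSpace ℝ W := NormedSpace.induced ℝ _ _ (coords W)
  let : NormedAddCommGroup X := NormedAddCommGroup.induced _ _ (coords X) (coords X).injective
  let : NormedSpace ℝ X := NormedSpace.induced ℝ _ _ (coords X)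
  rw [hasVelocity_iff_hasDerivAt] at *
  let B' : V →L[ℝ] W →L[ℝ] X := LinearMap.toContinuousLinearMap
    ((LinearMap.toContinuousLinearMap (𝕜 := ℝ) (E := W) (F' := X)).toLinearMap ∘ₗ B)
  have := (B'.hasFDerivAt.comp_hasDerivAt t h).clm_apply k
  exact this

theorem eq_of_hasVelocity_zero {σ : ℝ → V} (h : ∀ t, HasVelocity σ 0 t) (t u : ℝ) :
    σ t = σ u := by
  apply (coords V).injective
  refine is_const_of_deriv_eq_zero (f := fun u => coords V (σ u))
    (fun t => (h t).differentiableAt) (fun t => ?_) t u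
  have := (h t).deriv
  simpa using this

theorem HasVelocity.neg_comp {σ : ℝ → V} {v : V} {t : ℝ}
    (h : HasVelocity σ v (-t)) : HasVelocity (fun u => σ (-u)) (-v) t := by
  simpa using h.scomp (hasDerivAt_neg t)

end Velocity

/-! ### Exponentials of endomorphisms and derivations -/

section OneParameterGroups

variable {V W : Type*} [AddCommGroup V] [Module ℝ V] [Module.Finite ℝ V]
  [AddCommGroup W] [Module ℝ W] [Module.Finite ℝ W]

theorem exists_oneParameterGroup (A : Module.End ℝ V) :
    ∃ h : ℝ → Module.End ℝ V, h 0 = 1 ∧ (∀ s t, h (s + t) = h s * h t) ∧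
      (∀ t, HasVelocity h (A * h t) t) := by
  let : NormedAddCommGroup V := NormedAddCommGroup.induced _ _ (coords V) (coords V).injective
  let : NormedSpace ℝ V := NormedSpace.induced ℝ _ _ (coords V)
  let A' : V →L[ℝ] V := LinearMap.toContinuousLinearMap A
  let : NormedAlgebra ℚ (V →L[ℝ] V) := NormedAlgebra.restrictScalars ℚ ℝ _
  refine ⟨fun t => (NormedSpace.exp (t • A') : V →L[ℝ] V).toLinearMap, ?_, ?_, ?_⟩
  · simp only [zero_smul, NormedSpace.exp_zero]
    rfl
  · intro s t
    beta_reduce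
    rw [add_smul, NormedSpace.exp_add_of_commute (((Commute.refl A').smul_left s).smul_right t)]
    rfl
  · intro t
    have h := hasDerivAt_exp_smul_const' (𝕂 := ℝ) A' t
    have h2 := (hasVelocity_iff_hasDerivAt.2 h).linear
      (LinearMap.toContinuousLinearMap (𝕜 := ℝ) (E := V) (F' := V)).symm.toLinearMap
    exact h2

/-- The endomorphism `e^{tA}`. -/
def expEnd (A : Module.End ℝ V) : ℝ → Module.End ℝ V := (exists_oneParameterGroup A).choose

@[simp] theorem expEnd_zero (A : Module.End ℝ V) : expEnd A 0 = 1 :=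
  (exists_oneParameterGroup A).choose_spec.1

theorem expEnd_add (A : Module.End ℝ V) (s t : ℝ) :
    expEnd A (s + t) = expEnd A s * expEnd A t :=
  (exists_oneParameterGroup A).choose_spec.2.1 s t

theorem hasVelocity_expEnd (A : Module.End ℝ V) (t : ℝ) :
    HasVelocity (expEnd A) (A * expEnd A t) t :=
  (exists_oneParameterGroup A).choose_spec.2.2 t

theorem expEnd_mul_neg (A : Module.End ℝ V) (t : ℝ) : expEnd A t * expEnd A (-t) = 1 := by
  rw [← expEnd_add, add_neg_cancel, expEnd_zero]

theorem expEnd_neg_mul (A : Module.End ℝ V) (t : ℝ) : expEnd A (-t) * expEnd A t = 1 := by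
  rw [← expEnd_add, neg_add_cancel, expEnd_zero]

/-- The automorphism `e^{tA}`. -/
def expEquiv (A : Module.End ℝ V) (t : ℝ) : V ≃ₗ[ℝ] V :=
  LinearEquiv.ofLinearMap (expEnd A t) (expEnd A (-t)) (expEnd_mul_neg A t) (expEnd_neg_mul A t)

@[simp] theorem expEquiv_apply (A : Module.End ℝ V) (t : ℝ) (x : V) :
    expEquiv A t x = expEnd A t x := rfl

@[simp] theorem expEquiv_symm_apply (A : Module.End ℝ V) (t : ℝ) (x : V) :
    (expEquiv A t).symm x = expEnd A (-t) x := rfl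

theorem hasVelocity_expEnd_apply (A : Module.End ℝ V) (x : V) (t : ℝ) :
    HasVelocity (fun u => expEnd A u x) (A (expEnd A t x)) t :=
  (hasVelocity_expEnd A t).linear (LinearMap.applyₗ x)

theorem hasVelocity_expEnd_commute (A : Module.End ℝ V) (t : ℝ) :
    HasVelocity (expEnd A) (expEnd A t * A) t := by
  have h1 : HasVelocity (fun u => expEnd A t * expEnd A (u - t)) (expEnd A t * A) t := by
    have := (hasVelocity_expEnd A (t - t)).scomp (s := fun u => u - t) ((hasDerivAt_id t).sub_const t)
    have := this.linear (LinearMap.mulLeft ℝ (expEnd A t))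
    simpa using this
  refine h1.congr_of_eventuallyEq (Filter.Eventually.of_forall fun u => ?_)
  rw [← expEnd_add, add_sub_cancel]

theorem expEnd_commute (A : Module.End ℝ V) (t : ℝ) : A * expEnd A t = expEnd A t * A :=
  (hasVelocity_expEnd A t).unique (hasVelocity_expEnd_commute A t)

/-- Uniqueness for the linear equation `y' = By`. -/
theorem eq_expEnd_apply (B : Module.End ℝ W) {y : ℝ → W} (h : ∀ t, HasVelocity y (B (y t)) t)
    (t : ℝ) : y t = expEnd B t (y 0) := by
  -- Integrating factor: `e^{-uB} y(u)` is constant.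
  have h1 : ∀ u, HasVelocity (fun u => expEnd B (-u) (y u)) 0 u := by
    intro u
    have h2 : HasVelocity (fun u => expEnd B (-u)) (-(expEnd B (-u) * B)) u :=
      (hasVelocity_expEnd_commute B (-u)).neg_comp
    have := h2.bilinear (LinearMap.id : (Module.End ℝ W) →ₗ[ℝ] W →ₗ[ℝ] W) (h u)
    simpa using this
  have h3 := eq_of_hasVelocity_zero h1 t 0
  simp only [neg_zero, expEnd_zero, Module.End.one_apply] at h3
  rw [← h3, ← Module.End.mul_apply, expEnd_mul_neg, Module.End.one_apply]

/-- Both sides solve `y' = By` with initial value `T x`. -/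
theorem intertwine_expEnd {A : Module.End ℝ V} {B : Module.End ℝ W} (T : V →ₗ[ℝ] W)
    (h : ∀ x, T (A x) = B (T x)) (t : ℝ) (x : V) : T (expEnd A t x) = expEnd B t (T x) := by
  have := eq_expEnd_apply B (y := fun u => T (expEnd A u x))
    (fun u => by rw [← h]; exact (hasVelocity_expEnd_apply A x u).linear T) t
  simpa using this

theorem expEnd_apply_eigenvector {A : Module.End ℝ V} {x : V} {c : ℝ} (h : A x = c • x) (t : ℝ) :
    expEnd A t x = Real.exp (t * c) • x := by
  have := eq_expEnd_apply A (y := fun u => Real.exp (u * c) • x) (fun u => by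
    have h1 : HasDerivAt (fun u => Real.exp (u * c)) (Real.exp (u * c) * c) u := by
      simpa using (((hasDerivAt_id u).mul_const c)).exp
    have := (hasVelocity_iff_hasDerivAt.2 h1).linear (LinearMap.toSpanSingleton ℝ V x)
    simpa [h, mul_smul] using this) t
  simpa using this.symm

/-- By the Leibniz rule the right-hand side solves `y' = Dy`, as does the left. -/
theorem expEnd_lie {L : Type*} [LieRing L] [LieAlgebra ℝ L] [Module.Finite ℝ L]
    (D : LieDerivation ℝ L L) (t : ℝ) (x y : L) :
    expEnd D.toLinearMap t ⁅x, y⁆ = ⁅expEnd D.toLinearMap t x, expEnd D.toLinearMap t y⁆ := by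
  have := eq_expEnd_apply D.toLinearMap
    (y := fun u => ⁅expEnd D.toLinearMap u x, expEnd D.toLinearMap u y⁆) (fun u => by
      have h := (hasVelocity_expEnd_apply D.toLinearMap x u).bilinear
        (LieModule.toEnd ℝ L L : L →ₗ[ℝ] L →ₗ[ℝ] L) (hasVelocity_expEnd_apply D.toLinearMap y u)
      have e := D.apply_lie_eq_add (expEnd D.toLinearMap u x) (expEnd D.toLinearMap u y)
      rw [add_comm] at e
      change HasVelocity _ (D _) _
      rw [e]
      exact h) t
  simpa using this.symm

/-- The automorphism `e^{tD}` of a Lie algebra. -/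
def expLieEquiv {L : Type*} [LieRing L] [LieAlgebra ℝ L] [Module.Finite ℝ L]
    (D : LieDerivation ℝ L L) (t : ℝ) : L ≃ₗ⁅ℝ⁆ L :=
  { expEquiv D.toLinearMap t with
    map_lie' := fun {x y} => expEnd_lie D t x y }

end OneParameterGroups

/-! ### The action on tensors and its differential -/

section Action

variable {ι P : Type*} [AddCommGroup P] [Module ℝ P] {r s : ℕ}

theorem act_trans (h k : P ≃ₗ[ℝ] P) (γ : Tuple ι P r s) :
    act (k.trans h) γ = act h (act k γ) := by
  funext i
  ext v
  have : (PiTensorProduct.map fun _ : Fin s => ((k.trans h : P ≃ₗ[ℝ] P) : P →ₗ[ℝ] P)) =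
      (PiTensorProduct.map fun _ : Fin s => (h : P →ₗ[ℝ] P)) ∘ₗ
        (PiTensorProduct.map fun _ : Fin s => (k : P →ₗ[ℝ] P)) := by
    rw [← PiTensorProduct.map_comp]
    rfl
  simp only [act, LinearMap.compMultilinearMap_apply, this, LinearMap.comp_apply]
  rfl

/-- The action of `h ∈ GL(P)` on tuples of tensors is linear. -/
def actLinear (h : P ≃ₗ[ℝ] P) : Tuple ι P r s →ₗ[ℝ] Tuple ι P r s where
  toFun := act h
  map_add' γ δ := by
    funext i
    ext v
    simp [act]
  map_smul' c γ := by
    funext i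
    ext v
    simp [act]

@[simp] theorem actLinear_apply (h : P ≃ₗ[ℝ] P) (γ : Tuple ι P r s) : actLinear h γ = act h γ := rfl

theorem theta_id (γ : Tuple ι P r s) : theta LinearMap.id γ = ((s : ℝ) - r) • γ := by
  funext i
  ext v
  have h1 : thetaTensorPower s (LinearMap.id : P →ₗ[ℝ] P) = (s : ℝ) • LinearMap.id := by
    simp [thetaTensorPower, PiTensorProduct.map_id, Nat.cast_smul_eq_nsmul]
  simp only [theta, h1, Function.update_eq_self, MultilinearMap.compLinearMap_id,
    Finset.sum_const, Finset.card_univ, Fintype.card_fin, sub_smul, Pi.smul_apply,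
    sub_apply, ← Nat.cast_smul_eq_nsmul ℝ r, smul_apply]
  rfl

theorem theta_sub (A B : Module.End ℝ P) (γ : Tuple ι P r s) :
    theta (A - B) γ = theta A γ - theta B γ := by
  rw [eq_sub_iff_add_eq, ← theta_add, sub_add_cancel]

theorem theta_sub_eq_zero {A B : Module.End ℝ P} {γ : Tuple ι P r s}
    (h : theta A γ = theta B γ) : theta (A - B) γ = 0 := by
  rw [theta_sub, h, sub_self]

/-- Scalar multiplication by a nonzero number. -/
def homothety (c : ℝ) (hc : c ≠ 0) : P ≃ₗ[ℝ] P := LinearEquiv.smulOfNeZero ℝ P c hc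

theorem act_homothety (c : ℝ) (hc : c ≠ 0) (γ : Tuple ι P r s) :
    act (homothety c hc) γ = (c ^ s * (c⁻¹) ^ r) • γ := by
  funext i
  ext v
  have h1 : (PiTensorProduct.map fun _ : Fin s => ((homothety c hc : P ≃ₗ[ℝ] P) : P →ₗ[ℝ] P)) =
      c ^ s • LinearMap.id := by
    have := (PiTensorProduct.mapMultilinear ℝ (fun _ : Fin s => P) (fun _ => P)).map_smul_univ
      (fun _ => c) (fun _ => LinearMap.id)
    simp only [Finset.prod_const, Finset.card_univ, Fintype.card_fin,
      PiTensorProduct.mapMultilinear_apply, PiTensorProduct.map_id] at this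
    rw [← this]
    rfl
  have h2 : γ i (fun j => c⁻¹ • v j) = c⁻¹ ^ r • γ i v := by
    rw [(γ i).map_smul_univ (fun _ => c⁻¹) v]
    simp
  have h3 : act (homothety c hc) γ i v =
    (PiTensorProduct.map fun _ : Fin s => ((homothety c hc : P ≃ₗ[ℝ] P) : P →ₗ[ℝ] P))
      (γ i fun j => c⁻¹ • v j) := rfl
  rw [h3, h1, h2]
  simp [mul_smul, smul_comm (c ^ s)]

variable [Module.Finite ℝ P]

theorem act_expEquiv_add (A : Module.End ℝ P) (t u : ℝ) (γ : Tuple ι P r s) :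
    act (expEquiv A (t + u)) γ = act (expEquiv A t) (act (expEquiv A u) γ) := by
  rw [← act_trans]
  congr 1
  ext x
  simp [← Module.End.mul_apply, ← expEnd_add]

theorem act_expEquiv_zero (A : Module.End ℝ P) (γ : Tuple ι P r s) :
    act (expEquiv A 0) γ = γ := by
  have : expEquiv A 0 = LinearEquiv.refl ℝ P := by ext x; simp
  rw [this]
  funext i
  ext v
  have h : (PiTensorProduct.map fun _ : Fin s => ((LinearEquiv.refl ℝ P : P ≃ₗ[ℝ] P) : P →ₗ[ℝ] P))
      = LinearMap.id := PiTensorProduct.map_id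
  simp only [act, LinearMap.compMultilinearMap_apply, h]
  rfl

/-- A one-parameter group generated by a multiple of the identity acts by homotheties. -/
theorem act_expEquiv_add_smul_id (A : Module.End ℝ P) (a t : ℝ) (γ : Tuple ι P r s) :
    act (expEquiv (a • LinearMap.id + A) t) γ =
      Real.exp (t * (a * ((s : ℝ) - r))) • act (expEquiv A t) γ := by
  have key : expEquiv (a • LinearMap.id + A) t =
      (expEquiv A t).trans (homothety (Real.exp (t * a)) (Real.exp_ne_zero _)) := by
    ext x
    have h : ∀ u, HasVelocity (fun u => Real.exp (u * a) • expEnd A u x)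
        ((a • LinearMap.id + A : Module.End ℝ P) (Real.exp (u * a) • expEnd A u x)) u := fun u => by
      have h1 : HasDerivAt (fun u => Real.exp (u * a)) (Real.exp (u * a) * a) u := by
        simpa using (((hasDerivAt_id u).mul_const a)).exp
      have := (hasVelocity_iff_hasDerivAt.2 h1).bilinear (LinearMap.lsmul ℝ P)
        (hasVelocity_expEnd_apply A x u)
      simpa [mul_smul, smul_comm a] using this
    have := eq_expEnd_apply _ h t
    simp only [zero_mul, Real.exp_zero, expEnd_zero, Module.End.one_apply, one_smul] at this
    rw [expEquiv_apply, ← this]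
    rfl
  rw [key, act_trans, act_homothety]
  congr 1
  rw [← Real.exp_neg, ← Real.exp_nat_mul, ← Real.exp_nat_mul, ← Real.exp_add]
  congr 1
  ring

variable [Finite ι]
theorem hasVelocity_pi {V : Type*} [AddCommGroup V] [Module ℝ V] [Module.Finite ℝ V]
    {σ : ℝ → ι → V} {v : ι → V} {t : ℝ} (h : ∀ i, HasVelocity (fun u => σ u i) (v i) t) :
    HasVelocity σ v t := by
  classical
  have := Fintype.ofFinite ι
  let _ : NormedAddCommGroup V := NormedAddCommGroup.induced _ _ (coords V) (coords V).injective
  let _ : NormedSpace ℝ V := NormedSpace.induced ℝ _ _ (coords V)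
  rw [hasVelocity_iff_hasDerivAt]
  exact hasDerivAt_pi.2 fun i => hasVelocity_iff_hasDerivAt.1 (h i)

/-- The action is multilinear in `s` copies of `e^{uA}` on the outputs and `r` copies of `e^{-uA}`
on the inputs. The product rule gives one summand of `theta` for each copy, with a minus sign for
the inputs. -/
theorem hasVelocity_act_zero (A : Module.End ℝ P) (γ : Tuple ι P r s) :
    HasVelocity (fun u => act (expEquiv A u) γ) (theta A γ) 0 := by
  refine hasVelocity_pi fun i => ?_
  have hA : HasVelocity (expEnd A) A 0 := by simpa using hasVelocity_expEnd A 0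
  have hA' : HasVelocity (fun u => expEnd A (-u)) (-A) 0 := by
    refine HasVelocity.neg_comp ?_
    simpa using hA
  have h1 := HasVelocity.multilinear (t := 0)
    (PiTensorProduct.mapMultilinear ℝ (fun _ : Fin s => P) (fun _ => P))
    (x := fun _ => expEnd A) (v := fun _ => A) fun _ => hA
  let C : MultilinearMap ℝ (fun _ : Fin r => Module.End ℝ P) (Tensor P r s) :=
    (LinearMap.applyₗ (γ i)).compMultilinearMap
      (MultilinearMap.compLinearMapMultilinear (R := ℝ) (ι := Fin r) (M₁ := fun _ => P)
        (M₁' := fun _ => P) (M₂ := ⨂[ℝ] _ : Fin s, P))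
  have h3 := HasVelocity.multilinear (t := 0) C
    (x := fun _ u => expEnd A (-u)) (v := fun _ => -A) fun _ => hA'
  let B : Module.End ℝ (⨂[ℝ] _ : Fin s, P) →ₗ[ℝ] Tensor P r s →ₗ[ℝ] Tensor P r s :=
    LinearMap.mk₂ ℝ (fun T g => T.compMultilinearMap g)
      (fun _ _ _ => by ext; simp) (fun _ _ _ => by ext; simp)
      (fun _ _ _ => by ext; simp) (fun _ _ _ => by ext; simp)
  have h4 := h1.bilinear B h3
  have hC : ∀ j : Fin r, C (Function.update (fun _ => LinearMap.id) j (-A)) =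
      -C (Function.update (fun _ => LinearMap.id) j A) := fun j => C.map_update_neg _ _ _
  suffices h : theta A γ i = _ by
    rw [h]
    exact h4
  simp only [neg_zero, expEnd_zero, Module.End.one_eq_id, hC]
  ext v
  simp [theta, B, C, thetaTensorPower, sub_eq_add_neg, PiTensorProduct.map_id]

theorem hasVelocity_act (A : Module.End ℝ P) (γ : Tuple ι P r s) (t : ℝ) :
    HasVelocity (fun u => act (expEquiv A u) γ) (act (expEquiv A t) (theta A γ)) t := by
  have h := hasVelocity_act_zero A γ
  rw [← sub_self t] at h
  have h1 := (h.scomp (s := fun u => u - t) ((hasDerivAt_id t).sub_const t)).linear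
    (actLinear (expEquiv A t))
  rw [one_smul] at h1
  refine h1.congr_of_eventuallyEq (Filter.Eventually.of_forall fun u => ?_)
  rw [actLinear_apply, ← act_trans]
  congr 1
  ext x
  simp [← Module.End.mul_apply, ← expEnd_add]

/-- Both sides are the velocity at `0` of `u ↦ h e^{uA}·γ = e^{u hAh⁻¹} h·γ`. -/
theorem theta_conj_act (h : P ≃ₗ[ℝ] P) (A : Module.End ℝ P) (γ : Tuple ι P r s) :
    theta (h.conj A) (act h γ) = act h (theta A γ) := by
  refine (hasVelocity_act_zero (h.conj A) (act h γ)).unique ?_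
  refine ((hasVelocity_act_zero A γ).linear (actLinear h)).congr_of_eventuallyEq
    (Filter.Eventually.of_forall fun u => ?_)
  rw [actLinear_apply, ← act_trans, ← act_trans]
  congr 1
  ext x
  simpa using (intertwine_expEnd (A := A) (B := h.conj A) (h : P →ₗ[ℝ] P)
    (fun y => by simp [LinearEquiv.conj_apply]) u x).symm

theorem act_eq_of_theta_eq_zero {A : Module.End ℝ P} {γ : Tuple ι P r s} (h : theta A γ = 0)
    (t : ℝ) : act (expEquiv A t) γ = γ := by
  rw [← act_expEquiv_zero A γ]
  conv_lhs => rw [act_expEquiv_zero]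
  refine eq_of_hasVelocity_zero (σ := fun u => act (expEquiv A u) γ) (fun u => ?_) t 0
  have := hasVelocity_act A γ u
  rwa [h, show act (expEquiv A u) (0 : Tuple ι P r s) = 0 from
    (actLinear (expEquiv A u)).map_zero] at this

end Action

/-! ### Real and imaginary parts in the complexification -/

section Complexification

variable {V W : Type*} [AddCommGroup V] [Module ℝ V] [AddCommGroup W] [Module ℝ W]

/-- The real part of an element of the complexification. -/
def complexRe (V : Type*) [AddCommGroup V] [Module ℝ V] : ℂ ⊗[ℝ] V →ₗ[ℝ] V :=
  (TensorProduct.lid ℝ V).toLinearMap ∘ₗ Complex.reLm.rTensor V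

/-- The imaginary part of an element of the complexification. -/
def complexIm (V : Type*) [AddCommGroup V] [Module ℝ V] : ℂ ⊗[ℝ] V →ₗ[ℝ] V :=
  (TensorProduct.lid ℝ V).toLinearMap ∘ₗ Complex.imLm.rTensor V

@[simp] theorem complexRe_tmul (z : ℂ) (v : V) : complexRe V (z ⊗ₜ v) = z.re • v := rfl

@[simp] theorem complexIm_tmul (z : ℂ) (v : V) : complexIm V (z ⊗ₜ v) = z.im • v := rfl

theorem complexRe_smul (z : ℂ) (x : ℂ ⊗[ℝ] V) :
    complexRe V (z • x) = z.re • complexRe V x - z.im • complexIm V x := by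
  induction x with
  | zero => simp
  | tmul w v => simp [TensorProduct.smul_tmul', sub_smul, mul_smul]
  | add x y hx hy => simp only [smul_add, map_add, hx, hy]; abel

theorem complexIm_smul (z : ℂ) (x : ℂ ⊗[ℝ] V) :
    complexIm V (z • x) = z.re • complexIm V x + z.im • complexRe V x := by
  induction x with
  | zero => simp
  | tmul w v => simp [TensorProduct.smul_tmul', add_smul, mul_smul]
  | add x y hx hy => simp only [smul_add, map_add, hx, hy]; abel

theorem complexRe_baseChange (f : V →ₗ[ℝ] W) (x : ℂ ⊗[ℝ] V) :
    complexRe W (f.baseChange ℂ x) = f (complexRe V x) := by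
  induction x with
  | zero => simp
  | tmul w v => simp
  | add x y hx hy => simp only [map_add, hx, hy]

theorem complexIm_baseChange (f : V →ₗ[ℝ] W) (x : ℂ ⊗[ℝ] V) :
    complexIm W (f.baseChange ℂ x) = f (complexIm V x) := by
  induction x with
  | zero => simp
  | tmul w v => simp
  | add x y hx hy => simp only [map_add, hx, hy]

theorem eq_complexRe_add_complexIm (x : ℂ ⊗[ℝ] V) :
    x = (1 : ℂ) ⊗ₜ complexRe V x + Complex.I ⊗ₜ complexIm V x := by
  induction x with
  | zero => simp
  | tmul w v =>
    simp only [complexRe_tmul, complexIm_tmul, ← TensorProduct.smul_tmul, ← TensorProduct.add_tmul]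
    congr 1
    apply Complex.ext <;> simp
  | add x y hx hy =>
    conv_lhs => rw [hx, hy]
    simp only [map_add, TensorProduct.tmul_add]
    abel

theorem complex_ext_zero {x : ℂ ⊗[ℝ] V} (h1 : complexRe V x = 0) (h2 : complexIm V x = 0) :
    x = 0 := by
  rw [eq_complexRe_add_complexIm x, h1, h2]
  simp

end Complexification

/-! ### Generalized eigenspaces -/

section Eigenspaces

open Module.End

variable {C : Type*} [Field C] {V W : Type*} [AddCommGroup V] [Module C V] [AddCommGroup W]
  [Module C W]

theorem mem_maxGenEigenspace_of_sub_mem {T : Module.End C V} {c : C} {x : V}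
    (h : T x - c • x ∈ T.maxGenEigenspace c) : x ∈ T.maxGenEigenspace c := by
  rw [mem_maxGenEigenspace] at *
  obtain ⟨k, hk⟩ := h
  exact ⟨k + 1, by simpa [pow_succ] using hk⟩

theorem map_mem_maxGenEigenspace {T : Module.End C V} {U : Module.End C W} (f : V →ₗ[C] W)
    (h : ∀ x, f (T x) = U (f x)) {c : C} {x : V} (hx : x ∈ T.maxGenEigenspace c) :
    f x ∈ U.maxGenEigenspace c := by
  rw [mem_maxGenEigenspace] at *
  obtain ⟨k, hk⟩ := hx
  refine ⟨k, ?_⟩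
  suffices ∀ (k : ℕ) (x : V), f (((T - c • 1) ^ k : Module.End C V) x) =
      ((U - c • 1) ^ k : Module.End C W) (f x) by rw [← this, hk, map_zero]
  intro k
  induction k with
  | zero => simp
  | succ k ih => intro x; simp [pow_succ, ih, h]

/-- Since `(T-c-d)⁅x,y⁆ = ⁅(T-c)x,y⁆ + ⁅x,(T-d)y⁆`, induction on the sum of the two nilpotency
exponents applies. -/
theorem lie_mem_maxGenEigenspace {L : Type*} [LieRing L] [LieAlgebra C L] {T : Module.End C L}
    (hT : ∀ x y, T ⁅x, y⁆ = ⁅T x, y⁆ + ⁅x, T y⁆) {c d : C} {x y : L}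
    (hx : x ∈ T.maxGenEigenspace c) (hy : y ∈ T.maxGenEigenspace d) :
    ⁅x, y⁆ ∈ T.maxGenEigenspace (c + d) := by
  rw [mem_maxGenEigenspace] at hx hy
  obtain ⟨k, hk⟩ := hx
  obtain ⟨l, hl⟩ := hy
  induction hn : k + l generalizing k l x y with
  | zero =>
    obtain ⟨rfl, rfl⟩ : k = 0 ∧ l = 0 := by omega
    simp_all
  | succ n ih =>
    rcases k with _ | k
    · have : x = 0 := by simpa using hk
      simp [this]
    rcases l with _ | l
    · have : y = 0 := by simpa using hl
      simp [this]
    apply mem_maxGenEigenspace_of_sub_mem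
    have e : T ⁅x, y⁆ - (c + d) • ⁅x, y⁆ = ⁅(T - c • 1) x, y⁆ + ⁅x, (T - d • 1) y⁆ := by
      simp only [hT, LinearMap.sub_apply, LinearMap.smul_apply, one_apply, sub_lie, lie_sub,
        smul_lie, lie_smul, add_smul]
      abel
    rw [e]
    refine Submodule.add_mem _ (ih k ?_ (l + 1) hl (by omega)) (ih (k + 1) hk l ?_ (by omega))
    · simpa [pow_succ] using hk
    · simpa [pow_succ] using hl

variable [IsAlgClosed C] [FiniteDimensional C V]

theorem exists_scalar_on_maxGenEigenspace (T : Module.End C V) (φ : C → C) :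
    ∃ R : Module.End C V, ∀ c, ∀ x ∈ T.maxGenEigenspace c, R x = φ c • x := by
  classical
  have hI : DirectSum.IsInternal T.maxGenEigenspace :=
    DirectSum.isInternal_submodule_of_iSupIndep_of_iSup_eq_top
      T.independent_maxGenEigenspace T.iSup_maxGenEigenspace_eq_top
  let e := LinearEquiv.ofBijective (DirectSum.coeLinearMap T.maxGenEigenspace) hI
  refine ⟨DirectSum.toModule C C V (fun c => φ c • (T.maxGenEigenspace c).subtype) ∘ₗ
    e.symm.toLinearMap, fun c x hx => ?_⟩
  have h : e.symm x = DirectSum.lof C C (fun c => T.maxGenEigenspace c) c ⟨x, hx⟩ := by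
    rw [LinearEquiv.symm_apply_eq]
    exact (DirectSum.coeLinearMap_lof (R := C) T.maxGenEigenspace c ⟨x, hx⟩).symm
  simp [h]

theorem induction_maxGenEigenspace (T : Module.End C V) {p : V → Prop}
    (h0 : p 0) (hadd : ∀ x y, p x → p y → p (x + y))
    (h : ∀ c, ∀ x ∈ T.maxGenEigenspace c, p x) (x : V) : p x := by
  have hx : x ∈ ⨆ c, T.maxGenEigenspace c := by
    rw [T.iSup_maxGenEigenspace_eq_top]
    trivial
  exact Submodule.iSup_induction _ (motive := p) hx h h0 hadd

end Eigenspaces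

/-! ### Real parts of derivations and of normal operators -/

section RealPart

open Module.End

/-- The part of a derivation that acts on the generalized eigenspace of the eigenvalue `c` as
`φ c`, where `φ` is a linear retraction of the scalar extension, is again a derivation. -/
theorem exists_derivation_of_retraction {C : Type*} [Field C] [IsAlgClosed C] [Algebra ℝ C]
    (φ : C →ₗ[ℝ] ℝ) (hφ : φ 1 = 1)
    {L : Type*} [LieRing L] [LieAlgebra ℝ L] [Module.Finite ℝ L]
    (D : LieDerivation ℝ L L) {W : Type*} [AddCommGroup W] [Module ℝ W]
    (f : L →ₗ[ℝ] W) (T S : Module.End ℝ W) (hf : ∀ x, f (D x) = T (f x))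
    (hS : ∀ c, ∀ x ∈ maxGenEigenspace (T.baseChange C) c,
      S.baseChange C x = algebraMap ℝ C (φ c) • x) :
    ∃ D' : LieDerivation ℝ L L, ∀ x, f (D' x) = S (f x) := by
  let Dc : Module.End C (C ⊗[ℝ] L) := D.toLinearMap.baseChange C
  have hDc : ∀ x y, Dc ⁅x, y⁆ = ⁅Dc x, y⁆ + ⁅x, Dc y⁆ := by
    intro x y
    induction x with
    | zero => simp
    | add x z hx hz => simp only [add_lie, map_add, hx, hz]; abel
    | tmul a v =>
      induction y with
      | zero => simp
      | add x z hx hz => simp only [lie_add, map_add, hx, hz]; abel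
      | tmul b w =>
        have := D.apply_lie_eq_add v w
        simp only [Dc, LinearMap.baseChange_tmul, LieAlgebra.ExtendScalars.bracket_tmul,
          LieDerivation.coeFn_coe, ← TensorProduct.tmul_add, this, add_comm]
  obtain ⟨R, hR⟩ := exists_scalar_on_maxGenEigenspace Dc fun c => algebraMap ℝ C (φ c)
  -- On the eigenspaces of `c` and `d` the two sides are `φ(c+d)` and `φ(c)+φ(d)` times the bracket,
  -- so additivity of `φ` is what matters.
  have hRlie : ∀ x y, R ⁅x, y⁆ = ⁅R x, y⁆ + ⁅x, R y⁆ := by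
    intro x y
    induction x using induction_maxGenEigenspace Dc with
    | h0 => simp
    | hadd x z hx hz => simp only [add_lie, map_add, hx, hz]; abel
    | h c x hx =>
      induction y using induction_maxGenEigenspace Dc with
      | h0 => simp
      | hadd x z hx hz => simp only [lie_add, map_add, hx, hz]; abel
      | h d y hy =>
        rw [hR _ _ hx, hR _ _ hy, hR _ _ (lie_mem_maxGenEigenspace hDc hx hy), smul_lie, lie_smul,
          map_add, map_add, add_smul]
  -- `ρ` applies `φ` to the scalars to return to `L`. It commutes with brackets by elements of `L`,
  -- so composing it with `R` preserves the Leibniz rule on `L`.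
  let ρ : C ⊗[ℝ] L →ₗ[ℝ] L := (TensorProduct.lid ℝ L).toLinearMap ∘ₗ φ.rTensor L
  let ρ' : C ⊗[ℝ] W →ₗ[ℝ] W := (TensorProduct.lid ℝ W).toLinearMap ∘ₗ φ.rTensor W
  have hρ : ∀ x (y : L), ρ ⁅x, (1 : C) ⊗ₜ[ℝ] y⁆ = ⁅ρ x, y⁆ := by
    intro x y
    induction x with
    | zero => simp
    | tmul w v => simp [ρ]
    | add x z hx hz => simp only [add_lie, map_add, hx, hz]
  have hρ₁ : ∀ (y : L) x, ρ ⁅(1 : C) ⊗ₜ[ℝ] y, x⁆ = ⁅y, ρ x⁆ := by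
    intro y x
    induction x with
    | zero => simp
    | tmul w v => simp [ρ]
    | add x z hx hz => simp only [lie_add, map_add, hx, hz]
  have hρf : ∀ x, ρ' (f.baseChange C x) = f (ρ x) := by
    intro x
    induction x with
    | zero => simp
    | tmul w v => simp [ρ, ρ']
    | add x y hx hy => simp only [map_add, hx, hy]
  let D₀ : L →ₗ[ℝ] L := ρ ∘ₗ R.restrictScalars ℝ ∘ₗ TensorProduct.mk ℝ C L 1
  have hD₀ : ∀ x, D₀ x = ρ (R ((1 : C) ⊗ₜ x)) := fun _ => rfl
  refine ⟨⟨D₀, fun x y => ?_⟩, fun x => ?_⟩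
  · have h1 : ((1 : C) ⊗ₜ[ℝ] ⁅x, y⁆ : C ⊗[ℝ] L) = ⁅(1 : C) ⊗ₜ[ℝ] x, (1 : C) ⊗ₜ[ℝ] y⁆ := by simp
    rw [hD₀, h1, hRlie, map_add, hρ, hρ₁, ← hD₀, ← hD₀, ← lie_skew, ← sub_eq_neg_add]
  -- `f` maps the generalized eigenspaces of `D` into those of `T` for the same `c`, where `S` is `φ
  -- c`.
  · have key : ∀ x, f.baseChange C (R x) = S.baseChange C (f.baseChange C x) := by
      intro x
      induction x using induction_maxGenEigenspace Dc with
      | h0 => simp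
      | hadd x z hx hz => simp only [map_add, hx, hz]
      | h c x hx =>
        rw [hR _ _ hx, map_smul, hS c]
        refine map_mem_maxGenEigenspace _ (fun y => ?_) hx
        induction y with
        | zero => simp
        | add x z hx hz => simp only [map_add, hx, hz]
        | tmul a v => simp [Dc, hf]
    change f (D₀ x) = _
    rw [hD₀, ← hρf, key, LinearMap.baseChange_tmul, LinearMap.baseChange_tmul]
    simp [ρ', hφ]

variable {V : Type*} [AddCommGroup V] [Module ℝ V] {B : LinearMap.BilinForm ℝ V}

/-- With `x = a + ib`, the identity `B(Sa,b) = B(a,Sb)` reads `Im c · (B(a,a) + B(b,b)) = 0`. -/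
theorem eigenvalue_im_eq_zero_of_symm (hpos : ∀ x, x ≠ 0 → 0 < B x x)
    {S : Module.End ℝ V} (hS : ∀ x y, B (S x) y = B x (S y)) {c : ℂ} {x : ℂ ⊗[ℝ] V} (hx : x ≠ 0)
    (h : S.baseChange ℂ x = c • x) : c.im = 0 := by
  have h1 := congrArg (complexRe V) h
  have h2 := congrArg (complexIm V) h
  rw [complexRe_baseChange, complexRe_smul] at h1
  rw [complexIm_baseChange, complexIm_smul] at h2
  set a := complexRe V x with ha
  set b := complexIm V x with hb
  have h3 := hS a b
  rw [h1, h2] at h3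
  simp only [map_sub, map_add, map_smul, LinearMap.sub_apply, LinearMap.smul_apply,
    smul_eq_mul] at h3
  have h4 : c.im * (B a a + B b b) = 0 := by linarith
  have ha0 : 0 ≤ B a a := by
    by_cases h : a = 0
    · simp [h]
    · exact (hpos a h).le
  have hb0 : 0 ≤ B b b := by
    by_cases h : b = 0
    · simp [h]
    · exact (hpos b h).le
  rcases mul_eq_zero.1 h4 with h | h
  · exact h
  · refine absurd (complex_ext_zero (x := x) ?_ ?_) hx
    · by_contra h'
      have := hpos _ h'
      linarith
    · by_contra h'
      have := hpos _ h'
      linarith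

/-- With `x = a + ib`, adding `B(Na,a) = 0` and `B(Nb,b) = 0` cancels the mixed terms and leaves `Re
c · (B(a,a) + B(b,b)) = 0`. -/
theorem eigenvalue_re_eq_zero_of_skew (hB : ∀ x y, B x y = B y x) (hpos : ∀ x, x ≠ 0 → 0 < B x x)
    {N : Module.End ℝ V} (hN : ∀ x y, B (N x) y = -B x (N y)) {c : ℂ} {x : ℂ ⊗[ℝ] V} (hx : x ≠ 0)
    (h : N.baseChange ℂ x = c • x) : c.re = 0 := by
  have h1 := congrArg (complexRe V) h
  have h2 := congrArg (complexIm V) h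
  rw [complexRe_baseChange, complexRe_smul] at h1
  rw [complexIm_baseChange, complexIm_smul] at h2
  set a := complexRe V x with ha
  set b := complexIm V x with hb
  have h3 := hN a a
  have h3' := hN b b
  rw [h1] at h3
  rw [h2] at h3'
  simp only [map_sub, map_add, map_smul, LinearMap.sub_apply, LinearMap.add_apply,
    LinearMap.smul_apply, smul_eq_mul, hB b a] at h3 h3'
  have h4 : c.re * (B a a + B b b) = 0 := by linarith
  have ha0 : 0 ≤ B a a := by
    by_cases h : a = 0
    · simp [h]
    · exact (hpos a h).le
  have hb0 : 0 ≤ B b b := by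
    by_cases h : b = 0
    · simp [h]
    · exact (hpos b h).le
  rcases mul_eq_zero.1 h4 with h | h
  · exact h
  · refine absurd (complex_ext_zero (x := x) ?_ ?_) hx
    · by_contra h'
      have := hpos _ h'
      linarith
    · by_contra h'
      have := hpos _ h'
      linarith

/-- For a diagonalizable symmetric `S` and a skew-symmetric `N` commuting with it, `S` is the real
part of `S + N`. -/
theorem realPart_of_normal [Module.Finite ℝ V] (hB : ∀ x y, B x y = B y x) (hpos : ∀ x, x ≠ 0 → 0 < B x x)
    {S N : Module.End ℝ V} (hS : ∀ x y, B (S x) y = B x (S y)) (hN : ∀ x y, B (N x) y = -B x (N y))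
    (hSN : S * N = N * S) {κ : Type*} (β : Module.Basis κ ℝ V) {m : κ → ℝ}
    (hβ : ∀ i, S (β i) = m i • β i) {c : ℂ} {x : ℂ ⊗[ℝ] V}
    (hx : x ∈ maxGenEigenspace ((S + N).baseChange ℂ) c) :
    S.baseChange ℂ x = (c.re : ℂ) • x := by
  set T : Module.End ℂ (ℂ ⊗[ℝ] V) := (S + N).baseChange ℂ with hT
  set Sc : Module.End ℂ (ℂ ⊗[ℝ] V) := S.baseChange ℂ with hSc
  set Nc : Module.End ℂ (ℂ ⊗[ℝ] V) := N.baseChange ℂ with hNc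
  have hTSN : T = Sc + Nc := LinearMap.baseChange_add _ _
  have hcomm : Commute Sc Nc := by
    change Sc * Nc = Nc * Sc
    rw [hSc, hNc, ← LinearMap.baseChange_mul, ← LinearMap.baseChange_mul, hSN]
  have hcommT : Commute T Sc := by
    rw [hTSN]
    exact (Commute.refl Sc).add_left hcomm.symm
  have htop : ⨆ d, Sc.eigenspace d = ⊤ := by
    rw [eq_top_iff, ← (β.baseChange ℂ).span_eq, Submodule.span_le]
    rintro _ ⟨i, rfl⟩
    refine Submodule.mem_iSup_of_mem (m i : ℂ) ?_
    rw [mem_eigenspace_iff]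
    simp [hSc, hβ, TensorProduct.tmul_smul, TensorProduct.smul_tmul']
  have hinv : ∀ y ∈ T.maxGenEigenspace c, Sc y ∈ T.maxGenEigenspace c := fun y hy =>
    mapsTo_maxGenEigenspace_of_comm hcommT c hy
  -- The generalized eigenspace of `T` is `S`-invariant, hence the sum of its intersections with the
  -- eigenspaces of `S`. It suffices to treat one intersection, where `S = d`.
  have hdec := Submodule.inf_iSup_genEigenspace hinv 1
  have htop' : ⨆ d, Sc.genEigenspace d 1 = ⊤ := htop
  rw [htop', inf_top_eq] at hdec
  rw [hdec] at hx
  refine Submodule.iSup_induction _ (motive := fun x => Sc x = (c.re : ℂ) • x) hx ?_ (by simp)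
    (fun x y hx hy => by rw [map_add, hx, hy, smul_add])
  rintro d x ⟨hxT, hxS⟩
  have hxS' : Sc x = d • x := mem_eigenspace_iff.1 hxS
  by_cases hx0 : x = 0
  · simp [hx0]
  have hd : d.im = 0 := eigenvalue_im_eq_zero_of_symm hpos hS hx0 hxS'
  obtain ⟨k, hk⟩ := (mem_maxGenEigenspace _ _ _).1 hxT
  -- On powers applied to `x`, `T - c` agrees with `N - (c-d)`. As a power kills `x ≠ 0`, `c - d` is
  -- an eigenvalue of `N`, so it is imaginary; `d` being real, `d = Re c`.
  set Z : Module.End ℂ (ℂ ⊗[ℝ] V) := Nc - (c - d) • 1 with hZ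
  have hZcomm : Commute Sc Z := hcomm.sub_right ((Commute.one_right Sc).smul_right _)
  have hTZ : ∀ y, Sc y = d • y → (Sc + Nc - c • 1 : Module.End ℂ (ℂ ⊗[ℝ] V)) y = Z y := by
    intro y hy
    simp only [LinearMap.sub_apply, LinearMap.add_apply, hy, LinearMap.smul_apply, one_apply,
      sub_smul, hZ]
    abel
  have hpow : ∀ k : ℕ, ((T - c • 1) ^ k : Module.End ℂ (ℂ ⊗[ℝ] V)) x = (Z ^ k) x ∧
      Sc ((Z ^ k) x) = d • (Z ^ k) x := by
    intro k
    induction k with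
    | zero => simpa using hxS'
    | succ k ih =>
      refine ⟨?_, ?_⟩
      · rw [pow_succ', pow_succ', mul_apply, mul_apply, ih.1, hTSN]
        exact hTZ _ ih.2
      · rw [pow_succ', mul_apply, ← mul_apply, hZcomm.eq, mul_apply, ih.2, map_smul]
  have hev : Nc.HasEigenvalue (c - d) := by
    intro hne
    have hinj : Function.Injective Z := by
      rw [← LinearMap.ker_eq_bot, ← hne]
      exact (eigenspace_def).symm
    have h3 : Function.Injective (Z ^ k : Module.End ℂ (ℂ ⊗[ℝ] V)) := by
      rw [coe_pow]
      exact hinj.iterate k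
    exact hx0 (h3 (by rw [← (hpow k).1, hk, map_zero]))
  obtain ⟨y, hy⟩ := hev.exists_hasEigenvector
  have hre := eigenvalue_re_eq_zero_of_skew hB hpos hN hy.2 (mem_eigenspace_iff.1 hy.1)
  rw [hxS']
  congr 1
  apply Complex.ext
  · rw [Complex.sub_re] at hre
    simp only [Complex.ofReal_re]
    linarith
  · simpa using hd

end RealPart

/-! ### Orthonormal eigenbases -/

section Diagonalization

variable {V : Type*} [AddCommGroup V] [Module ℝ V]

/-- The spectral theorem for an inner product given by a bilinear form. -/
theorem exists_orthonormal_eigenbasis [Module.Finite ℝ V] {B : LinearMap.BilinForm ℝ V}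
    (hB : ∀ x y, B x y = B y x) (hpos : ∀ x, x ≠ 0 → 0 < B x x) {S : Module.End ℝ V}
    (hS : ∀ x y, B (S x) y = B x (S y)) :
    ∃ (β : Module.Basis (Fin (Module.finrank ℝ V)) ℝ V) (m : Fin (Module.finrank ℝ V) → ℝ),
      (∀ i j, B (β i) (β j) = if i = j then 1 else 0) ∧ ∀ i, S (β i) = m i • β i := by
  let core : InnerProductSpace.Core ℝ V :=
    { inner := fun x y => B x y
      conj_inner_symm := fun x y => hB y x
      re_inner_nonneg := fun x => by
        by_cases h : x = 0
        · simp [h]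
        · exact (hpos x h).le
      add_left := fun x y z => by simp
      smul_left := fun x y c => by simp
      definite := fun x h => by
        by_contra hx
        exact (hpos x hx).ne' h }
  let _ : NormedAddCommGroup V := core.toNormedAddCommGroup
  let _ : InnerProductSpace ℝ V := InnerProductSpace.ofCore core.toCore
  have hsymm : S.IsSymmetric := fun x y => hS x y
  let b := hsymm.eigenvectorBasis (rfl : Module.finrank ℝ V = Module.finrank ℝ V)
  refine ⟨b.toBasis, hsymm.eigenvalues rfl, fun i j => ?_, fun i => ?_⟩
  · rw [b.coe_toBasis]
    exact orthonormal_iff_ite.1 b.orthonormal i j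
  · rw [b.coe_toBasis]
    exact hsymm.apply_eigenvectorBasis rfl i

theorem toMatrix_isDiag_of_eigenbasis {κ : Type*} [Fintype κ] [DecidableEq κ]
    {β : Module.Basis κ ℝ V} {S : Module.End ℝ V} {m : κ → ℝ} (h : ∀ i, S (β i) = m i • β i) :
    (LinearMap.toMatrix β β S).IsDiag := by
  intro i j hij
  rw [LinearMap.toMatrix_apply, h, map_smul, Finsupp.smul_apply, Module.Basis.repr_self,
    Finsupp.single_apply, if_neg (Ne.symm hij), smul_zero]

end Diagonalization

/-! ### Uniqueness of solutions and the time change -/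

section Uniqueness

variable {V : Type*} [AddCommGroup V] [Module ℝ V] [Module.Finite ℝ V]

theorem HasVelocity.continuousAt {σ : ℝ → V} {v : V} {t : ℝ} (h : HasVelocity σ v t) :
    ContinuousAt (fun u => coords V (σ u)) t :=
  HasDerivAt.continuousAt h

/-- Uniqueness of solutions in `Γ` of the equation given by a locally Lipschitz map on `Γ`. -/
theorem solution_unique {q : V → V} {Γ : Set V} (hq : IsLocallyLipschitzOn q Γ) {J : Set ℝ}
    (hJ : IsOpen J) (hJc : IsPreconnected J) {t₀ : ℝ} (ht₀ : t₀ ∈ J) {σ τ : ℝ → V}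
    (hσ : ∀ t ∈ J, σ t ∈ Γ ∧ HasVelocity σ (q (σ t)) t)
    (hτ : ∀ t ∈ J, τ t ∈ Γ ∧ HasVelocity τ (q (τ t)) t) (h0 : σ t₀ = τ t₀) :
    ∀ t ∈ J, σ t = τ t := by
  have hloc : ∀ t ∈ J, σ t = τ t → ∀ᶠ u in 𝓝 t, σ u = τ u := by
    intro t ht he
    obtain ⟨C, s, hs, hL⟩ := hq (x := coords V (σ t)) ⟨σ t, (hσ t ht).1, rfl⟩
    have hev : ∀ {ρ : ℝ → V}, (∀ t ∈ J, ρ t ∈ Γ ∧ HasVelocity ρ (q (ρ t)) t) → ρ t = σ t →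
        ∀ᶠ u in 𝓝 t, HasDerivAt (fun u => coords V (ρ u))
          (coords V (q ((coords V).symm (coords V (ρ u))))) u ∧ coords V (ρ u) ∈ s := by
      intro ρ hρ hρt
      have hc : Filter.Tendsto (fun u => coords V (ρ u)) (𝓝 t)
          (𝓝[coords V '' Γ] (coords V (σ t))) := by
        rw [← hρt]
        refine tendsto_nhdsWithin_iff.2 ⟨(hρ t ht).2.continuousAt, ?_⟩
        filter_upwards [hJ.mem_nhds ht] with u hu
        exact ⟨_, (hρ u hu).1, rfl⟩
      filter_upwards [hJ.mem_nhds ht, hc hs] with u hu hus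
      refine ⟨?_, hus⟩
      rw [LinearEquiv.symm_apply_apply]
      exact (hρ u hu).2
    have := ODE_solution_unique_of_eventually (t₀ := t) (s := fun _ => s)
      (v := fun _ x => coords V (q ((coords V).symm x))) (Filter.Eventually.of_forall fun _ => hL)
      (hev hσ rfl) (hev hτ he.symm) (congrArg (coords V) he)
    exact this.mono fun u hu => (coords V).injective hu
  -- The set of times near which the curves agree is open, and it is closed in `J` by continuity and
  -- `hloc`.
  let U := {t | t ∈ J ∧ ∀ᶠ u in 𝓝 t, σ u = τ u}
  have hU : IsOpen U := by
    rw [isOpen_iff_mem_nhds]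
    rintro t ⟨ht, h⟩
    filter_upwards [hJ.mem_nhds ht, eventually_eventually_nhds.2 h] with u hu hu'
    exact ⟨hu, hu'⟩
  have hsub : J ⊆ U := by
    refine hJc.subset_of_closure_inter_subset hU ⟨t₀, ht₀, ht₀, hloc t₀ ht₀ h0⟩ ?_
    rintro t ⟨htU, ht⟩
    refine ⟨ht, hloc t ht ?_⟩
    have : (𝓝[U] t).NeBot := mem_closure_iff_nhdsWithin_neBot.1 htU
    apply (coords V).injective
    refine tendsto_nhds_unique_of_eventuallyEq (l := 𝓝[U] t)
      ((hσ t ht).2.continuousAt.mono_left nhdsWithin_le_nhds)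
      ((hτ t ht).2.continuousAt.mono_left nhdsWithin_le_nhds) ?_
    filter_upwards [self_mem_nhdsWithin] with u hu
    rw [hu.2.self_of_nhds]
  exact fun t ht => (hsub ht).2.self_of_nhds

/-- The solution `s` of `s' = e^{-κs}`, `s(0) = 0` on its maximal interval, its inverse, and its
behaviour at the end of the interval. -/
theorem exists_reparametrization (κ : ℝ) :
    ∃ (J : Set ℝ) (s τ : ℝ → ℝ), IsOpen J ∧ J.OrdConnected ∧ (0 : ℝ) ∈ J ∧ s 0 = 0 ∧
      (∀ t ∈ J, HasDerivAt s (Real.exp (-(κ * s t))) t) ∧ (∀ u, τ u ∈ J ∧ s (τ u) = u) ∧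
      -- `F` stands for `u → +∞` or `u → -∞`; its invariance under translation is needed in
      -- `act_limit`.
      ∀ T ∈ closure J, T ∉ J → ∃ F : Filter ℝ, F.NeBot ∧
        (∀ u, Filter.Tendsto (fun x => u + x) F F) ∧ Filter.Tendsto τ F (𝓝 T) := by
  by_cases hκ : κ = 0
  · refine ⟨Set.univ, id, id, isOpen_univ, Set.ordConnected_univ, trivial, rfl, fun t _ => ?_,
      fun u => ⟨trivial, rfl⟩, fun T _ hT => absurd trivial hT⟩
    simpa [hκ] using hasDerivAt_id t
  · have hcont : Continuous fun t : ℝ => 1 + κ * t := by fun_prop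
    refine ⟨{t | 0 < 1 + κ * t}, fun t => Real.log (1 + κ * t) / κ,
      fun u => (Real.exp (κ * u) - 1) / κ, isOpen_lt continuous_const hcont, ⟨?_⟩, ?_, by simp,
      fun t ht => ?_, fun u => ?_, fun T hT hTJ => ?_⟩
    · rintro x hx y hy z ⟨hxz, hzy⟩
      simp only [Set.mem_ofPred_eq] at *
      rcases le_total κ 0 with h | h
      · nlinarith
      · nlinarith
    · simp
    · have ht' : 0 < 1 + κ * t := ht
      have h1 : HasDerivAt (fun t => 1 + κ * t) κ t := by
        simpa using ((hasDerivAt_id t).const_mul κ).const_add 1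
      have h2 := (h1.log ht'.ne').div_const κ
      have h3 : Real.exp (-(κ * (Real.log (1 + κ * t) / κ))) = κ / (1 + κ * t) / κ := by
        rw [mul_div_cancel₀ _ hκ, Real.exp_neg, Real.exp_log ht']
        field_simp
      exact h3 ▸ h2
    · have h1 : 1 + κ * ((Real.exp (κ * u) - 1) / κ) = Real.exp (κ * u) := by
        field_simp
        ring
      simp only [Set.mem_ofPred_eq, h1, Real.log_exp]
      exact ⟨Real.exp_pos _, by field_simp⟩
    · have h0 : 0 ≤ 1 + κ * T :=
        closure_minimal (t := {t | 0 ≤ 1 + κ * t}) (fun t (ht : 0 < 1 + κ * t) => ht.le)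
          (isClosed_le continuous_const hcont) hT
      have hT0 : 1 + κ * T = 0 := le_antisymm (not_lt.1 hTJ) h0
      have hTval : T = (0 - 1) / κ := by
        field_simp
        linarith
      rw [hTval]
      -- The only finite end is `T = -1/κ`, reached where `e^{κu} → 0`; the sign of `κ` decides at
      -- which infinity.
      rcases lt_or_gt_of_ne hκ with h | h
      · refine ⟨Filter.atTop, inferInstance,
          fun u => Filter.tendsto_atTop_add_const_left _ u Filter.tendsto_id, ?_⟩
        refine Filter.Tendsto.div_const (Filter.Tendsto.sub_const ?_ 1) κ
        exact Real.tendsto_exp_atBot.comp (Filter.tendsto_id.const_mul_atTop_of_neg h)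
      · refine ⟨Filter.atBot, inferInstance,
          fun u => Filter.tendsto_atBot_add_const_left _ u Filter.tendsto_id, ?_⟩
        refine Filter.Tendsto.div_const (Filter.Tendsto.sub_const ?_ 1) κ
        exact Real.tendsto_exp_atBot.comp (Filter.tendsto_id.const_mul_atBot h)

end Uniqueness

/-! ### Flow lines of solitons -/

section Solitons

variable {ι P : Type*} [AddCommGroup P] [Module ℝ P] {r s : ℕ}

/-- The generator `A` of the one-parameter group that sweeps out the flow line of a soliton. -/
def solitonGenerator (r s : ℕ) (c : ℝ) (X : Module.End ℝ P) : Module.End ℝ P :=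
  (c / ((s : ℝ) - r)) • LinearMap.id + X

theorem theta_solitonGenerator (hrs : r ≠ s) (c : ℝ) (X : Module.End ℝ P) (γ : Tuple ι P r s) :
    theta (solitonGenerator r s c X) γ = c • γ + theta X γ := by
  have : (s : ℝ) - r ≠ 0 := sub_ne_zero.2 fun h => hrs (Nat.cast_injective h).symm
  rw [solitonGenerator, theta_add, theta_smul, theta_id, smul_smul, div_mul_cancel₀ _ this]

variable [Module.Finite ℝ P]

theorem act_solitonGenerator (hrs : r ≠ s) (c : ℝ) (X : Module.End ℝ P) (u : ℝ)
    (γ : Tuple ι P r s) : act (expEquiv (solitonGenerator r s c X) u) γ =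
      Real.exp (u * c) • act (expEquiv X u) γ := by
  have : (s : ℝ) - r ≠ 0 := sub_ne_zero.2 fun h => hrs (Nat.cast_injective h).symm
  rw [solitonGenerator, act_expEquiv_add_smul_id, div_mul_cancel₀ _ this]

/-- `X` generates a one-parameter group of symmetries of `Γ` for which `q` is equivariant. -/
def IsInfinitesimalSymmetry (Γ : Set (Tuple ι P r s)) (q : Tuple ι P r s → Tuple ι P r s)
    (X : Module.End ℝ P) : Prop :=
  ∀ γ ∈ Γ, ∀ t, act (expEquiv X t) γ ∈ Γ ∧
    q (act (expEquiv X t) γ) = act (expEquiv X t) (q γ)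

variable {Γ : Set (Tuple ι P r s)} {q : Tuple ι P r s → Tuple ι P r s} {X : Module.End ℝ P}
  {α c : ℝ} {γ : Tuple ι P r s}

/-- `e^{uA}` is the symmetry `e^{uX}` followed by scaling by `e^{uc}`. Under this scaling `q` gains
`e^{αuc}` instead of `e^{uc}`, whence the factor. -/
theorem act_solitonGenerator_mem (hrs : r ≠ s) (hX : IsInfinitesimalSymmetry Γ q X)
    (hmem : ∀ γ ∈ Γ, ∀ c : ℝ, 0 < c → c • γ ∈ Γ)
    (hq : ∀ γ ∈ Γ, ∀ c : ℝ, 0 < c → q (c • γ) = c ^ α • q γ) (hγ : γ ∈ Γ) (u : ℝ) :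
    act (expEquiv (solitonGenerator r s c X) u) γ ∈ Γ ∧
      q (act (expEquiv (solitonGenerator r s c X) u) γ) =
        Real.exp (-((1 - α) * c * u)) • act (expEquiv (solitonGenerator r s c X) u) (q γ) := by
  rw [act_solitonGenerator hrs, act_solitonGenerator hrs]
  obtain ⟨h1, h2⟩ := hX γ hγ u
  refine ⟨hmem _ h1 _ (Real.exp_pos _), ?_⟩
  rw [hq _ h1 _ (Real.exp_pos _), h2, smul_smul, ← Real.exp_mul, ← Real.exp_add]
  congr 2
  ring

variable [Finite ι]

namespace GeometryType

variable (𝒢 : GeometryType ι P r s)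

theorem eq_of_theta_eq (hγ : γ ∈ 𝒢.nondeg) {Q R : Module.End ℝ P} (hQ : Q ∈ 𝒢.compl γ)
    (hR : R ∈ 𝒢.compl γ) (h : theta Q γ = theta R γ) : Q = R := by
  have h1 : Q - R ∈ stab γ := by
    exact theta_sub_eq_zero h
  exact sub_eq_zero.1 (Submodule.disjoint_def.1 (𝒢.isCompl γ hγ).disjoint _ h1
    (Submodule.sub_mem _ hQ hR))

theorem act_mem_nondeg (hγ : γ ∈ 𝒢.nondeg) (h : P ≃ₗ[ℝ] P) : act h γ ∈ 𝒢.nondeg := by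
  rw [𝒢.nondeg_eq_orbit γ hγ]
  exact ⟨h, rfl⟩

theorem conj_mem_compl (hγ : γ ∈ 𝒢.nondeg) (h : P ≃ₗ[ℝ] P) {Q : Module.End ℝ P}
    (hQ : Q ∈ 𝒢.compl γ) : h.conj Q ∈ 𝒢.compl (act h γ) := by
  rw [𝒢.compl_act γ hγ]
  exact ⟨Q, hQ, rfl⟩

/-- `e^{tN}` fixes `γ`, so by naturality it preserves `g_γ`; differentiate at `t = 0`. -/
theorem metric_skew (hγ : γ ∈ 𝒢.nondeg) {N : Module.End ℝ P} (hN : theta N γ = 0) (x y : P) :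
    𝒢.metric γ (N x) y = -𝒢.metric γ x (N y) := by
  have h1 : ∀ z : P, HasVelocity (fun t => expEnd N t z) (N z) 0 := fun z => by
    simpa using hasVelocity_expEnd_apply N z 0
  have h2 := (h1 x).bilinear (𝒢.metric γ) (h1 y)
  have h3 : HasVelocity (fun t => 𝒢.metric γ (expEnd N t x) (expEnd N t y)) 0 0 := by
    refine (HasVelocity.const (𝒢.metric γ x y) 0).congr_of_eventuallyEq
      (Filter.Eventually.of_forall fun t => ?_)
    have := 𝒢.metric_act γ hγ (expEquiv N (-t)) x y
    rw [act_eq_of_theta_eq_zero hN] at this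
    simpa using this.symm
  have h4 := h2.unique h3
  simp only [expEnd_zero, Module.End.one_apply] at h4
  linarith

/-- A symmetric operator whose one-parameter group fixes a nondegenerate tuple vanishes. -/
theorem eq_zero_of_act_eq (hγ : γ ∈ 𝒢.nondeg) {A : Module.End ℝ P} {κ : Type*}
    (β : Module.Basis κ ℝ P) {m : κ → ℝ} (hβ : ∀ i, A (β i) = m i • β i)
    (h : ∀ u, act (expEquiv A u) γ = γ) : A = 0 := by
  refine β.ext fun i => ?_
  -- `e^A` is a `g_γ`-isometry, and it scales `β i` by `e^{m i}`.
  have h1 := 𝒢.metric_act γ hγ (expEquiv A 1) (β i) (β i)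
  have hpos := 𝒢.metric_pos γ hγ (β i) (β.ne_zero i)
  rw [h, expEquiv_symm_apply, expEnd_apply_eigenvector (hβ i)] at h1
  simp only [map_smul, LinearMap.smul_apply, smul_eq_mul] at h1
  have h2 : Real.exp (-1 * m i) * Real.exp (-1 * m i) = 1 := by
    have : (Real.exp (-1 * m i) * Real.exp (-1 * m i) - 1) * 𝒢.metric γ (β i) (β i) = 0 := by
      linarith
    rcases mul_eq_zero.1 this with h | h
    · linarith
    · exact absurd h hpos.ne'
  rw [← Real.exp_add, Real.exp_eq_one_iff] at h2
  have hm : m i = 0 := by linarith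
  simp [hβ, hm]

/-- The type `(r, s)` of a nondegenerate tuple satisfies `r ≠ s` unless the space is trivial. -/
theorem subsingleton_of_eq (hγ : γ ∈ 𝒢.nondeg) (hrs : r = s) : Subsingleton P := by
  -- For `r = s` scalars act trivially, so the identity lies in both the stabilizer and its
  -- complement.
  have h : theta (LinearMap.id : Module.End ℝ P) γ = 0 := by
    subst hrs
    rw [theta_id, sub_self, zero_smul]
  have h0 : (LinearMap.id : Module.End ℝ P) = 0 :=
    Submodule.disjoint_def.1 (𝒢.isCompl γ hγ).disjoint _ h (𝒢.id_mem_compl γ hγ)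
  refine subsingleton_of_forall_eq 0 fun x => ?_
  exact LinearMap.congr_fun h0 x

end GeometryType

/-- The flow line of a soliton. -/
theorem soliton_solution (hrs : r ≠ s) (hX : IsInfinitesimalSymmetry Γ q X)
    (hmem : ∀ γ ∈ Γ, ∀ c : ℝ, 0 < c → c • γ ∈ Γ)
    (hq : ∀ γ ∈ Γ, ∀ c : ℝ, 0 < c → q (c • γ) = c ^ α • q γ) (hγ : γ ∈ Γ)
    (hsol : q γ = c • γ + theta X γ) {σ : ℝ → ℝ} {t : ℝ}
    (hσ : HasDerivAt σ (Real.exp (-((1 - α) * c * σ t))) t) :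
    act (expEquiv (solitonGenerator r s c X) (σ t)) γ ∈ Γ ∧
    HasVelocity (fun t => act (expEquiv (solitonGenerator r s c X) (σ t)) γ)
      (q (act (expEquiv (solitonGenerator r s c X) (σ t)) γ)) t := by
  obtain ⟨h1, h2⟩ := act_solitonGenerator_mem (c := c) hrs hX hmem hq hγ (σ t)
  refine ⟨h1, ?_⟩
  rw [h2, hsol, ← theta_solitonGenerator hrs]
  exact (hasVelocity_act _ γ (σ t)).scomp hσ

/-- The operators of the structures on the flow line of a soliton. -/
theorem soliton_operator (𝒢 : GeometryType ι P r s) (hΓ : Γ ⊆ 𝒢.nondeg)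
    (hrs : r ≠ s) (hX : IsInfinitesimalSymmetry Γ q X)
    (hmem : ∀ γ ∈ Γ, ∀ c : ℝ, 0 < c → c • γ ∈ Γ)
    (hq : ∀ γ ∈ Γ, ∀ c : ℝ, 0 < c → q (c • γ) = c ^ α • q γ) (hγ : γ ∈ Γ)
    {Q : Module.End ℝ P} (hQ : Q ∈ 𝒢.compl γ) (hqQ : q γ = theta Q γ) (u : ℝ) :
    Real.exp (-((1 - α) * c * u)) • (expEquiv (solitonGenerator r s c X) u).conj Q ∈
        𝒢.compl (act (expEquiv (solitonGenerator r s c X) u) γ) ∧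
      q (act (expEquiv (solitonGenerator r s c X) u) γ) =
        theta (Real.exp (-((1 - α) * c * u)) • (expEquiv (solitonGenerator r s c X) u).conj Q)
          (act (expEquiv (solitonGenerator r s c X) u) γ) := by
  refine ⟨Submodule.smul_mem _ _ (𝒢.conj_mem_compl (hΓ hγ) _ hQ), ?_⟩
  rw [(act_solitonGenerator_mem hrs hX hmem hq hγ u).2, theta_smul, theta_conj_act, hqQ]

/-- The derivative of the conjugates at `0` is `[A,Q]`, which is therefore diagonal. Its diagonal
vanishes because `Q` is diagonal. -/
theorem commute_of_isDiag_conj {κ : Type*} [Fintype κ] [DecidableEq κ] (β : Module.Basis κ ℝ P)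
    {A Q : Module.End ℝ P}
    (h : ∀ u, (LinearMap.toMatrix β β ((expEquiv A u).conj Q)).IsDiag) : A * Q = Q * A := by
  have hQ : (LinearMap.toMatrix β β Q).IsDiag := by
    have : (expEquiv A 0).conj Q = Q := by
      ext x
      simp [LinearEquiv.conj_apply]
    rw [← this]
    exact h 0
  have hv : HasVelocity (fun u => (expEquiv A u).conj Q) (A * Q - Q * A) 0 := by
    have h1 : HasVelocity (expEnd A) A 0 := by simpa using hasVelocity_expEnd A 0
    have h2 : HasVelocity (fun u => expEnd A (-u)) (-A) 0 :=
      HasVelocity.neg_comp (by simpa using h1)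
    have h3 := (h1.linear (LinearMap.mulRight ℝ Q)).bilinear (LinearMap.mul ℝ (Module.End ℝ P)) h2
    have h4 : HasVelocity (fun u => expEnd A u * Q * expEnd A (-u)) (A * Q - Q * A) 0 := by
      simpa [sub_eq_add_neg] using h3
    exact h4
  have hoff : (LinearMap.toMatrix β β (A * Q - Q * A)).IsDiag := by
    intro i j hij
    have h1 := hv.linear (Matrix.entryLinearMap ℝ ℝ i j ∘ₗ (LinearMap.toMatrix β β).toLinearMap)
    refine h1.unique ((HasVelocity.const 0 0).congr_of_eventuallyEq
      (Filter.Eventually.of_forall fun u => ?_))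
    exact h u hij
  rw [← sub_eq_zero]
  apply (LinearMap.toMatrix β β).injective
  rw [map_zero]
  ext i j
  by_cases hij : i = j
  · subst hij
    have : ∀ M N : Matrix κ κ ℝ, N.IsDiag → (M * N - N * M) i i = 0 := by
      intro M N hN
      rw [← hN.diagonal_diag]
      simp [mul_comm]
    rw [map_sub, LinearMap.toMatrix_mul, LinearMap.toMatrix_mul]
    exact this _ _ hQ
  · exact hoff hij

/-- If the flow line of a soliton converges at an end of its interval of definition, then the limit
is fixed by the one-parameter group. -/
theorem act_limit {A : Module.End ℝ P} {F : Filter ℝ} [F.NeBot]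
    (hF : ∀ u, Filter.Tendsto (fun x => u + x) F F) {δ : Tuple ι P r s}
    (h : Filter.Tendsto (fun u => coords (Tuple ι P r s) (act (expEquiv A u) γ)) F
      (𝓝 (coords (Tuple ι P r s) δ))) (u : ℝ) : act (expEquiv A u) δ = δ := by
  let T := (coords (Tuple ι P r s)).toLinearMap ∘ₗ actLinear (expEquiv A u) ∘ₗ
    (coords (Tuple ι P r s)).symm.toLinearMap
  have hT : ∀ x, T (coords (Tuple ι P r s) x) = coords (Tuple ι P r s) (act (expEquiv A u) x) :=
    fun x => by simp [T]
  -- Both `h1` and `h2` compute the limit of `e^{(u+x)A}·γ`.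
  have h1 := (T.continuous_of_finiteDimensional.tendsto _).comp h
  have h2 := h.comp (hF u)
  apply (coords (Tuple ι P r s)).injective
  rw [← hT]
  refine tendsto_nhds_unique h1 (h2.congr fun x => ?_)
  simp only [Function.comp_apply, hT, act_expEquiv_add]

end Solitons

/-! ### Block endomorphisms -/

section Blocks

variable {L : Type*} [AddCommGroup L] [Module ℝ L] {𝔨 𝔭 : Submodule ℝ L}

/-- A block endomorphism is one that descends along the projection to `𝔭` with kernel `𝔨`. -/
theorem isBlock_iff (hc : IsCompl 𝔭 𝔨) {A : L →ₗ[ℝ] L} {h : 𝔭 →ₗ[ℝ] 𝔭} :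
    IsBlock 𝔨 𝔭 A h ↔
      ∀ x, Submodule.projectionOnto 𝔭 𝔨 hc (A x) =
        h (Submodule.projectionOnto 𝔭 𝔨 hc x) := by
  set f := Submodule.projectionOnto 𝔭 𝔨 hc with hf
  have hk : ∀ x, f x = 0 ↔ x ∈ 𝔨 := fun x => Submodule.projectionOnto_apply_eq_zero_iff hc
  have hp : ∀ x : 𝔭, f x = x := fun x => Submodule.projectionOnto_apply_left hc x
  constructor
  · rintro ⟨h1, h2⟩ x
    have h3 : f (A (x - f x)) = 0 := (hk _).2 (h1 _ ((hk _).1 (by rw [map_sub, hp, sub_self])))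
    have h4 := (hk _).2 (h2 (f x))
    rw [map_sub, hp] at h4
    rw [map_sub, map_sub] at h3
    rw [← sub_eq_zero.1 h4]
    exact sub_eq_zero.1 h3
  · intro h1
    refine ⟨fun x hx => ?_, fun x => ?_⟩
    · rw [← hk, h1, (hk x).2 hx, map_zero]
    · rw [← hk, map_sub, h1, hp, hp, sub_self]

theorem IsBlock.expEnd [Module.Finite ℝ L] (hc : IsCompl 𝔭 𝔨) {A : Module.End ℝ L}
    {h : Module.End ℝ 𝔭} (hA : IsBlock 𝔨 𝔭 A h) (t : ℝ) :
    IsBlock 𝔨 𝔭 (HomSoliton.expEnd A t) (HomSoliton.expEnd h t) :=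
  (isBlock_iff hc).2 fun x => intertwine_expEnd _ ((isBlock_iff hc).1 hA) t x

end Blocks

/-! ### Solitons on homogeneous spaces -/

section Homogeneous

variable {E : Type*} [NormedAddCommGroup E] [NormedSpace ℝ E] [FiniteDimensional ℝ E]
  {F : Type*} [NormedAddCommGroup F] [NormedSpace ℝ F]
  {G : Type*} [TopologicalSpace G] [ChartedSpace E G] [Group G] [LieGroup 𝓘(ℝ, E) ∞ G]
  {K : Subgroup G} [ChartedSpace F K] {𝔭 : Submodule ℝ (GroupLieAlgebra 𝓘(ℝ, E) G)}
  {ι : Type*} [Finite ι] {r s : ℕ} {𝒢 : GeometryType ι 𝔭 r s}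
  (Φ : PreferredDirection F K 𝔭 𝒢) {γ : Tuple ι 𝔭 r s}

namespace PreferredDirection

theorem isInfinitesimalSymmetry (hred : IsReductive F K 𝔭)
    {D : LieDerivation ℝ (GroupLieAlgebra 𝓘(ℝ, E) G) (GroupLieAlgebra 𝓘(ℝ, E) G)}
    {X : Module.End ℝ 𝔭} (hD : IsBlock (isotropyAlgebra E F K) 𝔭 D.toLinearMap X) :
    IsInfinitesimalSymmetry Φ.Γ Φ.q X := by
  intro γ hγ t
  have h : IsBlock (isotropyAlgebra E F K) 𝔭
      (expLieEquiv D t : GroupLieAlgebra 𝓘(ℝ, E) G →ₗ[ℝ] _) (expEquiv X t) :=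
    hD.expEnd hred.1.symm t
  exact ⟨Φ.aut_mem γ hγ (expLieEquiv D t) (expEquiv X t) h,
    Φ.q_aut γ hγ (expLieEquiv D t) (expEquiv X t) h⟩

theorem isSolution_soliton (hrs : r ≠ s) (hγ : γ ∈ Φ.Γ) {X : Module.End ℝ 𝔭}
    (hX : IsInfinitesimalSymmetry Φ.Γ Φ.q X) {c : ℝ} (hsol : Φ.q γ = c • γ + theta X γ)
    {J : Set ℝ} {σ : ℝ → ℝ} (hJ : IsOpen J) (hJc : J.OrdConnected) (h0 : (0 : ℝ) ∈ J)
    (hσ : ∀ t ∈ J, HasDerivAt σ (Real.exp (-((1 - Φ.α) * c * σ t))) t) :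
    Φ.IsSolution J fun t => act (expEquiv (solitonGenerator r s c X) (σ t)) γ :=
  ⟨hJ, hJc, h0, fun t ht =>
    soliton_solution hrs hX Φ.smul_mem Φ.q_smul hγ hsol (hσ t ht)⟩

/-- The generator of the flow line of a flow diagonal soliton commutes with the operator. -/
theorem solitonGenerator_commute (hrs : r ≠ s) (hγ : γ ∈ Φ.Γ) {X : Module.End ℝ 𝔭}
    (hX : IsInfinitesimalSymmetry Φ.Γ Φ.q X) {c : ℝ} (hsol : Φ.q γ = c • γ + theta X γ)
    {Q : Module.End ℝ 𝔭} (hQ : Φ.IsOperator γ Q) (hdiag : Φ.IsFlowDiagonal γ) :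
    solitonGenerator r s c X * Q = Q * solitonGenerator r s c X := by
  obtain ⟨J, σ, τ, hJ, hJc, h0, hσ0, hσ, hτ, -⟩ := exists_reparametrization ((1 - Φ.α) * c)
  obtain ⟨β, -, hβ⟩ := hdiag
  -- Every real `u` is the parameter of some time `τ u`, so all conjugates occur, up to a nonzero
  -- factor.
  refine commute_of_isDiag_conj β fun u => ?_
  obtain ⟨R, hR, hRd⟩ := hβ J _ (Φ.isSolution_soliton hrs hγ hX hsol hJ hJc h0 hσ)
    (by rw [hσ0, act_expEquiv_zero]) (τ u) (hτ u).1
  rw [(hτ u).2] at hR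
  obtain ⟨h1, h2⟩ := soliton_operator (c := c) 𝒢 Φ.nondeg hrs hX Φ.smul_mem Φ.q_smul hγ hQ.1 hQ.2 u
  have h3 := 𝒢.eq_of_theta_eq (𝒢.act_mem_nondeg (Φ.nondeg hγ) _) hR.1 h1 (hR.2.symm.trans h2)
  intro i j hij
  have h4 := hRd hij
  rw [h3, map_smul, Matrix.smul_apply, smul_eq_mul] at h4
  exact (mul_eq_zero.1 h4).resolve_left (Real.exp_ne_zero _)

theorem isAlgebraicSoliton_of_isFlowDiagonal (hred : IsReductive F K 𝔭) (hrs : r ≠ s)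
    (hγ : γ ∈ Φ.Γ) (hsoliton : Φ.IsSemiAlgebraicSoliton γ) {Q : Module.End ℝ 𝔭}
    (hQ : Φ.IsOperator γ Q) (hsymm : ∀ x y : 𝔭, 𝒢.metric γ (Q x) y = 𝒢.metric γ x (Q y))
    (hdiag : Φ.IsFlowDiagonal γ) : Φ.IsAlgebraicSoliton γ := by
  obtain ⟨c, D, X, hD, hsol⟩ := hsoliton
  have hγ' := Φ.nondeg hγ
  have hX := Φ.isInfinitesimalSymmetry hred hD
  have hcomm := Φ.solitonGenerator_commute hrs hγ hX hsol hQ hdiag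
  set A := solitonGenerator r s c X with hA
  set a : ℝ := c / ((s : ℝ) - r) with ha
  have hAX : A = a • LinearMap.id + X := rfl
  set S : Module.End ℝ 𝔭 := Q - a • LinearMap.id with hS
  set N : Module.End ℝ 𝔭 := A - Q with hN
  have hSN : S + N = X := by
    rw [hS, hN, hAX]
    abel
  have hNγ : theta N γ = 0 :=
    theta_sub_eq_zero (by rw [hA, theta_solitonGenerator hrs, ← hsol, ← hQ.2])
  have hSγ : Φ.q γ = c • γ + theta S γ := by
    rw [hsol, ← hSN, theta_add, hNγ, add_zero]
  have hcommSN : Commute S N :=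
    ((Commute.symm hcomm).sub_right (Commute.refl Q)).sub_left
      ((Commute.one_left N).smul_left a)
  have hSsymm : ∀ x y, 𝒢.metric γ (S x) y = 𝒢.metric γ x (S y) := by
    intro x y
    simp [hS, hsymm]
  obtain ⟨β, m, -, hβ⟩ := exists_orthonormal_eigenbasis (𝒢.metric_symm γ hγ')
    (𝒢.metric_pos γ hγ') hSsymm
  -- The derivation sought is the real part of `D`; it induces `S`, the real part of `X`.
  obtain ⟨D', hD'⟩ := exists_derivation_of_retraction Complex.reLm (by simp) D
    (Submodule.projectionOnto 𝔭 (isotropyAlgebra E F K) hred.1.symm) X S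
    ((isBlock_iff hred.1.symm).1 hD) (fun d x hx => by
      rw [← hSN] at hx
      exact realPart_of_normal (𝒢.metric_symm γ hγ') (𝒢.metric_pos γ hγ') hSsymm
        (𝒢.metric_skew hγ' hNγ) hcommSN.eq β hβ hx)
  exact ⟨c, D', S, (isBlock_iff hred.1.symm).2 hD', hSγ,
    Submodule.sub_mem _ hQ.1 (Submodule.smul_mem _ _ (𝒢.id_mem_compl γ hγ'))⟩

/-- A solution that starts at a soliton with diagonalizable generator stays on the orbit of the
one-parameter group of the generator, on any interval of definition. -/
theorem solution_eq_soliton (hrs : r ≠ s) (hγ : γ ∈ Φ.Γ) {X : Module.End ℝ 𝔭}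
    (hX : IsInfinitesimalSymmetry Φ.Γ Φ.q X) {c : ℝ} (hsol : Φ.q γ = c • γ + theta X γ)
    {κ : Type*} (β : Module.Basis κ ℝ 𝔭) {m : κ → ℝ}
    (hβ : ∀ i, solitonGenerator r s c X (β i) = m i • β i)
    {J : Set ℝ} {ρ : ℝ → Tuple ι 𝔭 r s} (hρ : Φ.IsSolution J ρ) (hρ0 : ρ 0 = γ) {t : ℝ}
    (ht : t ∈ J) : ∃ u, ρ t = act (expEquiv (solitonGenerator r s c X) u) γ := by
  set A := solitonGenerator r s c X with hA
  obtain ⟨hJ, hJc, hJ0, hρJ⟩ := hρ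
  -- For `A = 0` the solution is constant and may exist beyond the interval of the time change.
  by_cases hA0 : A = 0
  · refine ⟨0, ?_⟩
    rw [act_expEquiv_zero]
    refine solution_unique (τ := fun _ => γ) Φ.q_lipschitz hJ hJc.isPreconnected hJ0 hρJ
      (fun t _ => ⟨hγ, ?_⟩) hρ0 t ht
    have : Φ.q γ = 0 := by
      rw [hsol, ← theta_solitonGenerator hrs, ← hA, hA0]
      exact (stab γ).zero_mem
    rw [this]
    exact HasVelocity.const γ t
  obtain ⟨I, σ, τ, hI, hIc, hI0, hσ0, hσ, hτ, hend⟩ := exists_reparametrization ((1 - Φ.α) * c)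
  have hsolI := (Φ.isSolution_soliton hrs hγ hX hsol hI hIc hI0 hσ).2.2.2
  have heq : ∀ t ∈ J ∩ I, ρ t = act (expEquiv A (σ t)) γ :=
    solution_unique Φ.q_lipschitz (hJ.inter hI) (hJc.inter hIc).isPreconnected ⟨hJ0, hI0⟩
      (fun t ht => hρJ t ht.1) (fun t ht => hsolI t ht.2)
      (by rw [hρ0, hσ0, act_expEquiv_zero])
  suffices hJI : J ⊆ I from ⟨σ t, heq t ⟨ht, hJI ht⟩⟩
  refine hJc.isPreconnected.subset_of_closure_inter_subset hI ⟨0, hJ0, hI0⟩ ?_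
  rintro T ⟨hTI, hTJ⟩
  by_contra hT
  obtain ⟨f, hf, hfadd, hfτ⟩ := hend T hTI hT
  -- If `ρ` reached a finite end `T` of `I`, then `ρ T` would be the limit of `e^{uA}·γ`, hence a
  -- nondegenerate tuple fixed by every `e^{uA}`.
  refine hA0 (𝒢.eq_zero_of_act_eq (Φ.nondeg (hρJ T hTJ).1) β hβ (act_limit (γ := γ) hfadd ?_))
  refine ((hρJ T hTJ).2.continuousAt.tendsto.comp hfτ).congr' ?_
  filter_upwards [hfτ (hJ.mem_nhds hTJ)] with u hu
  simp only [Function.comp_apply]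
  rw [heq (τ u) ⟨hu, (hτ u).1⟩, (hτ u).2]

theorem isFlowDiagonal_of_isAlgebraicSoliton (hred : IsReductive F K 𝔭) (hrs : r ≠ s)
    (hγ : γ ∈ Φ.Γ) {Q : Module.End ℝ 𝔭} (hQ : Φ.IsOperator γ Q)
    (hsymm : ∀ x y : 𝔭, 𝒢.metric γ (Q x) y = 𝒢.metric γ x (Q y))
    (halg : Φ.IsAlgebraicSoliton γ) : Φ.IsFlowDiagonal γ := by
  obtain ⟨c, D, X, hD, hsol, hXc⟩ := halg
  have hγ' := Φ.nondeg hγ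
  have hX := Φ.isInfinitesimalSymmetry hred hD
  have hQA : Q = solitonGenerator r s c X := 𝒢.eq_of_theta_eq hγ' hQ.1
    (Submodule.add_mem _ (Submodule.smul_mem _ _ (𝒢.id_mem_compl γ hγ')) hXc)
    (by rw [theta_solitonGenerator hrs, ← hsol, hQ.2])
  obtain ⟨β, m, horth, hβ⟩ := exists_orthonormal_eigenbasis (𝒢.metric_symm γ hγ')
    (𝒢.metric_pos γ hγ') hsymm
  refine ⟨β, horth, fun J ρ hρ hρ0 t ht => ?_⟩
  obtain ⟨u, hu⟩ := Φ.solution_eq_soliton hrs hγ hX hsol β (hQA ▸ hβ) hρ hρ0 ht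
  obtain ⟨h1, h2⟩ := soliton_operator (c := c) 𝒢 Φ.nondeg hrs hX Φ.smul_mem Φ.q_smul hγ hQ.1 hQ.2 u
  rw [← hu] at h1 h2
  refine ⟨_, ⟨h1, h2⟩, ?_⟩
  have h3 : (expEquiv (solitonGenerator r s c X) u).conj Q = Q := by
    rw [← hQA]
    change HomSoliton.expEnd Q u * Q * HomSoliton.expEnd Q (-u) = Q
    rw [← expEnd_commute, mul_assoc, expEnd_mul_neg, mul_one]
  rw [h3]
  exact toMatrix_isDiag_of_eigenbasis (m := fun i => Real.exp (-((1 - Φ.α) * c * u)) * m i)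
    fun i => by rw [LinearMap.smul_apply, hβ, smul_smul]

/-- `GL(𝔭)` is trivial, so `Γ` is a point and its tangent vector `q γ` vanishes. -/
theorem isFlowDiagonal_of_subsingleton [Subsingleton 𝔭] (hγ : γ ∈ Φ.Γ) : Φ.IsFlowDiagonal γ := by
  have hsub : ∀ A : Module.End ℝ 𝔭, A = 0 := fun A => LinearMap.ext fun x => Subsingleton.elim _ _
  have hΓ : ∀ δ ∈ Φ.Γ, δ = γ := by
    intro δ hδ
    have h := Φ.nondeg hδ
    rw [𝒢.nondeg_eq_orbit γ (Φ.nondeg hγ)] at h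
    obtain ⟨h, rfl⟩ := h
    have : h = expEquiv 0 0 := LinearEquiv.ext fun x => Subsingleton.elim _ _
    rw [this]
    exact act_expEquiv_zero 0 γ
  have hq : Φ.q γ = 0 := by
    obtain ⟨σ, -, hσ, hv⟩ := Φ.q_tangent γ hγ
    exact hv.unique ((HasVelocity.const γ 0).congr_of_eventuallyEq (hσ.mono fun u hu => hΓ _ hu))
  obtain ⟨β, m, horth, -⟩ := exists_orthonormal_eigenbasis (𝒢.metric_symm γ (Φ.nondeg hγ))
    (𝒢.metric_pos γ (Φ.nondeg hγ)) (S := 0) (by simp)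
  refine ⟨β, horth, fun J ρ hρ _ t ht => ⟨0, ⟨Submodule.zero_mem _, ?_⟩, ?_⟩⟩
  · rw [hΓ _ (hρ.2.2.2 t ht).1, hq]
    exact (stab γ).zero_mem.symm
  · rw [map_zero]
    exact Matrix.isDiag_zero

end PreferredDirection

end Homogeneous

end HomSoliton

end

open HomSoliton in
theorem theorem6p2
    {E : Type*} [NormedAddCommGroup E] [NormedSpace ℝ E] [FiniteDimensional ℝ E]
    {F : Type*} [NormedAddCommGroup F] [NormedSpace ℝ F] [FiniteDimensional ℝ F]
    {G : Type*} [TopologicalSpace G] [T2Space G] [SecondCountableTopology G] [ChartedSpace E G]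
    [Group G] [LieGroup 𝓘(ℝ, E) ∞ G] [SimplyConnectedSpace G]
    (K : Subgroup G) [ChartedSpace F K] [LieGroup 𝓘(ℝ, F) ∞ K] (hK : IsLieSubgroup E F K)
    [ConnectedSpace K] [CompactSpace K]
    (heff : DiscreteTopology K.normalCore)
    (𝔭 : Submodule ℝ (GroupLieAlgebra 𝓘(ℝ, E) G)) (hred : IsReductive F K 𝔭)
    {ι : Type*} [Finite ι] {r s : ℕ} (𝒢 : GeometryType ι 𝔭 r s)
    (Φ : PreferredDirection F K 𝔭 𝒢)
    (γ : Tuple ι 𝔭 r s) (hγ : γ ∈ Φ.Γ) (hsoliton : Φ.IsSemiAlgebraicSoliton γ)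
    (Q : Module.End ℝ 𝔭) (hQ : Φ.IsOperator γ Q)
    (hsymm : ∀ x y : 𝔭, 𝒢.metric γ (Q x) y = 𝒢.metric γ x (Q y)) :
    Φ.IsFlowDiagonal γ ↔ Φ.IsAlgebraicSoliton γ := by

  -- The generator `A` divides by `s - r`, so `r = s` is treated apart; there `𝔭 = 0`.
  have hback : r = s → Subsingleton 𝔭 := 𝒢.subsingleton_of_eq (Φ.nondeg hγ)
  constructor
  · intro h
    by_cases hrs : r = s
    · have := hback hrs
      obtain ⟨c, D, X, hD, hsol⟩ := hsoliton
      have hX : X = 0 := LinearMap.ext fun x => Subsingleton.elim _ _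
      exact ⟨c, D, X, hD, hsol, hX ▸ Submodule.zero_mem _⟩
    · exact Φ.isAlgebraicSoliton_of_isFlowDiagonal hred hrs hγ hsoliton hQ hsymm h
  · intro h
    by_cases hrs : r = s
    · have := hback hrs
      exact Φ.isFlowDiagonal_of_subsingleton hγ
    · exact Φ.isFlowDiagonal_of_isAlgebraicSoliton hred hrs hγ hQ hsymm h
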